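/- Let $\alpha>1$, $r\in(0,\tfrac12)$, $\sigma\neq 0$ and $q,\ell\ge 0$. Let $\Lambda=\mathrm{diag}(\xi_1^2,\xi_2^2,\dots)$ and $\theta=(\theta_k)_{k\ge1}$ be given by the power laws $\xi_k^2=k^{-\alpha}$, $\theta_k=k^{-(1+2\alpha r)/2}$. For $n\ge 1$ take $\lambda=n^{-(\ell-1)}$ and $p=n^q$ (as a real parameter; more generally, any $p=p_n>0$ with $p_n/n^q\to1$, for instance $p=\lceil n^q\rceil$). Then the self-consistent equations $$n-\frac{\lambda}{\nu_1}=\mathrm{Tr}\big(\Lambda(\Lambda+\nu_2)^{-1}\big),\qquad p-\frac{p\,\nu_1}{\nu_2}=\mathrm{Tr}\big(\Lambda(\Lambda+\nu_2)^{-1}\big)$$ have exactly one solution $\nu_1,\nu_2>0$. Define $$\Upsilon=\frac pn\Big[\Big(1-\frac{\nu_1}{\nu_2}\Big)^2+\Big(\frac{\nu_1}{\nu_2}\Big)^2\frac{\mathrm{Tr}(\Lambda^2(\Lambda+\nu_2)^{-2})}{p-\mathrm{Tr}(\Lambda^2(\Lambda+\nu_2)^{-2})}\Big],\qquad \chi=\frac{\mathrm{Tr}(\Lambda(\Lambda+\nu_2)^{-2})}{p-\mathrm{Tr}(\Lambda^2(\Lambda+\nu_2)^{-2})},$$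 $$\mathsf B=\frac{\nu_2^2}{1-\Upsilon}\Big[\langle\theta,(\Lambda+\nu_2)^{-2}\theta\rangle+\chi\,\langle\theta,\Lambda(\Lambda+\nu_2)^{-2}\theta\rangle\Big],$$ and the deterministic equivalents of the risk and of the squared norm of the random feature ridge estimator (with noise variance $\sigma^2$), $$\mathsf R=\mathsf B+\frac{\sigma^2\Upsilon}{1-\Upsilon},\qquad \mathsf N=\frac{p\,\langle\theta,\Lambda(\Lambda+\nu_2)^{-2}\theta\rangle}{p-\mathrm{Tr}(\Lambda^2(\Lambda+\nu_2)^{-2})}+\frac{p\,\chi}{n}\,\mathsf B+\frac{\sigma^2 p}{n}\cdot\frac{\chi}{1-\Upsilon}.$$ Then, as $n\to\infty$, $\mathsf R=\Theta\big(n^{\gamma_n}\,\mathsf N^{\gamma_{\mathsf N}}\big)$ (with constants that may depend on the fixed parameters) in each of the following regions, with the exponents 1. $\ell>\alpha$ and $q>1$: $\ \gamma_n=-\alpha$, $\gamma_{\mathsf N}=1$; 2. $\frac{\alpha}{2\alpha r+1}<\ell<\alpha$ and $q>\frac{\ell}{\alpha}$: $\ \gamma_n=-\ell$, $\gamma_{\mathsf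 N}=1$; 3. $\frac{1}{2\alpha r+1}<q<1$ and $q<\frac{\ell}{\alpha}$: $\ \gamma_n=-\frac{\alpha}{\alpha+1}$, $\gamma_{\mathsf N}=\frac{1}{\alpha+1}$; 4. $\ell<\frac{\alpha}{2\alpha r+1}$ and $q>\frac{\ell}{\alpha}$: $\ \gamma_n=-\ell$, $\gamma_{\mathsf N}=1$; 5. $q<\frac{1}{2\alpha r+1}$ and $q<\frac{\ell}{\alpha}$: $\ \gamma_n=0$, $\gamma_{\mathsf N}=-\frac{2r}{1-2r}$. In particular $\gamma_n\le0$ in every region, $\gamma_{\mathsf N}>0$ in regions 1–4 (larger $q$), and $\gamma_{\mathsf N}<0$ in region 5 (small $q$). -/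

import Mathlib

/-!
Deterministic equivalents of the excess risk and of the squared `ℓ²` norm of the estimator in random
feature ridge regression.  The feature covariance is the diagonal operator `Λ = diag(Λ₀, Λ₁, …)` with
`Λ k > 0`, and the target has the coefficients `θ = (θ₀, θ₁, …)`.  Everything below is diagonal, so
that traces and quadratic forms are the sums of the corresponding diagonal entries.  For `ν > 0`,
`∑ Λ k < ∞` and `∑ (θ k)² < ∞` all these series have non-negative terms and converge.
-/

noncomputable section

namespace RFM

/-- `Tr(Λ (Λ + ν)⁻¹)`. -/
def df1 (Λ : ℕ → ℝ) (ν : ℝ) : ℝ := ∑' k, Λ k / (Λ k + ν)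

/-- `Tr(Λ² (Λ + ν)⁻²)`. -/
def df2 (Λ : ℕ → ℝ) (ν : ℝ) : ℝ := ∑' k, Λ k ^ 2 / (Λ k + ν) ^ 2

/-- `Tr(Λ (Λ + ν)⁻²)`. -/
def trRes2 (Λ : ℕ → ℝ) (ν : ℝ) : ℝ := ∑' k, Λ k / (Λ k + ν) ^ 2

/-- `⟨θ, (Λ + ν)⁻² θ⟩`. -/
def quad0 (Λ θ : ℕ → ℝ) (ν : ℝ) : ℝ := ∑' k, θ k ^ 2 / (Λ k + ν) ^ 2

/-- `⟨θ, Λ (Λ + ν)⁻² θ⟩`. -/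
def quad1 (Λ θ : ℕ → ℝ) (ν : ℝ) : ℝ := ∑' k, Λ k * θ k ^ 2 / (Λ k + ν) ^ 2

/-- The positive pair `(ν₁, ν₂)` solves the self-consistent equations
`n - lam / ν₁ = Tr(Λ (Λ + ν₂)⁻¹)` and `p - p ν₁ / ν₂ = Tr(Λ (Λ + ν₂)⁻¹)`. -/
def SelfConsistent (Λ : ℕ → ℝ) (n p lam ν₁ ν₂ : ℝ) : Prop :=
  0 < ν₁ ∧ 0 < ν₂ ∧ n - lam / ν₁ = df1 Λ ν₂ ∧ p - p * ν₁ / ν₂ = df1 Λ ν₂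

/-- `Υ(ν₁, ν₂)`. -/
def Upsilon (Λ : ℕ → ℝ) (n p ν₁ ν₂ : ℝ) : ℝ :=
  p / n * ((1 - ν₁ / ν₂) ^ 2 + (ν₁ / ν₂) ^ 2 * (df2 Λ ν₂ / (p - df2 Λ ν₂)))

/-- `χ(ν₂)`. -/
def chi (Λ : ℕ → ℝ) (p ν₂ : ℝ) : ℝ := trRes2 Λ ν₂ / (p - df2 Λ ν₂)

/-- Deterministic equivalent of the bias of the risk. -/
def biasR (Λ θ : ℕ → ℝ) (n p ν₁ ν₂ : ℝ) : ℝ :=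
  ν₂ ^ 2 / (1 - Upsilon Λ n p ν₁ ν₂) * (quad0 Λ θ ν₂ + chi Λ p ν₂ * quad1 Λ θ ν₂)

/-- Deterministic equivalent of the variance of the risk, with noise variance `σ²`. -/
def varR (Λ : ℕ → ℝ) (σ n p ν₁ ν₂ : ℝ) : ℝ :=
  σ ^ 2 * Upsilon Λ n p ν₁ ν₂ / (1 - Upsilon Λ n p ν₁ ν₂)

/-- Deterministic equivalent `R` of the excess risk. -/
def detRisk (Λ θ : ℕ → ℝ) (σ n p ν₁ ν₂ : ℝ) : ℝ :=
  biasR Λ θ n p ν₁ ν₂ + varR Λ σ n p ν₁ ν₂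

/-- Deterministic equivalent of the bias of the squared norm. -/
def biasN (Λ θ : ℕ → ℝ) (n p ν₁ ν₂ : ℝ) : ℝ :=
  p * quad1 Λ θ ν₂ / (p - df2 Λ ν₂) + p * chi Λ p ν₂ / n * biasR Λ θ n p ν₁ ν₂

/-- Deterministic equivalent of the variance of the squared norm: this is
`(p χ / (n Υ)) * varR` with the factor `Υ > 0` cancelled. -/
def varN (Λ : ℕ → ℝ) (σ n p ν₁ ν₂ : ℝ) : ℝ :=
  σ ^ 2 * (p / n) * (chi Λ p ν₂ / (1 - Upsilon Λ n p ν₁ ν₂))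

/-- Deterministic equivalent `N` of the squared norm of the estimator. -/
def detNorm (Λ θ : ℕ → ℝ) (σ n p ν₁ ν₂ : ℝ) : ℝ :=
  biasN Λ θ n p ν₁ ν₂ + varN Λ σ n p ν₁ ν₂

/-- Power-law spectrum `ξ_k² = k^{-α}`, `k = 1, 2, …`; the sequence is stored from index `0`. -/
def powerSpectrum (α : ℝ) (k : ℕ) : ℝ := ((k : ℝ) + 1) ^ (-α)

/-- Power-law target `θ_k = k^{-(1 + 2αr)/2}`, `k = 1, 2, …`; stored from index `0`. -/
def powerTarget (α r : ℝ) (k : ℕ) : ℝ := ((k : ℝ) + 1) ^ (-((1 + 2 * α * r) / 2))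

/-- Names of the five regions of the `(ℓ, q)` quadrant. -/
inductive Region : Type
  | one
  | two
  | three
  | four
  | five

/-- The point `(ℓ, q)` lies in the given region. -/
def Region.Contains (α r ℓ q : ℝ) : Region → Prop
  | .one => α < ℓ ∧ 1 < q
  | .two => α / (2 * α * r + 1) < ℓ ∧ ℓ < α ∧ ℓ / α < q
  | .three => 1 / (2 * α * r + 1) < q ∧ q < 1 ∧ q < ℓ / α
  | .four => ℓ < α / (2 * α * r + 1) ∧ ℓ / α < q
  | .five => q < 1 / (2 * α * r + 1) ∧ q < ℓ / α

/-- The exponent of the sample size `n`; it depends on `α` and `ℓ` only. -/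
def Region.gammaSample (α ℓ : ℝ) : Region → ℝ
  | .one => -α
  | .two => -ℓ
  | .three => -(α / (α + 1))
  | .four => -ℓ
  | .five => 0

/-- The exponent of the norm; it depends on `α` and `r` only. -/
def Region.gammaNorm (α r : ℝ) : Region → ℝ
  | .one => 1
  | .two => 1
  | .three => 1 / (α + 1)
  | .four => 1
  | .five => -(2 * r / (1 - 2 * r))

end RFM

end

/-! ### Two-sided power-law bounds for the resolvent sums. -/

noncomputable section

namespace RFM

/-! Write S, T for `df1`, `df2` at ν = ν₂, and D = ν · `trRes2`, so that S = T + D. For power laws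
each series except S is a `powerSum`, of order ν^{(a-1)/α - 2} for bounded ν (`isTheta_powerSum`):
terms with j below ν^{-1/α} see only j^{-α} in the denominator, later ones only ν. Hence S, T and D
are all of order ν^{-1/α}, while the quadratic forms `quad0` and `quad1` are of order ν^{2r-2} and
ν^{2r-1}.

Since p - T = (p - S) + D is of order p, these estimates give, as soon as 1 - Υ stays away from 0,
that the risk R and the product ν N are both of order ν^{2r} + S/n (`isTheta_detRisk_detNorm`). In
particular R is of order ν N, and only the size of ν remains to be found.

Eliminating ν₁ leaves the single equation n^{-ℓ} = ν (1 - S/p)(1 - S/n), whose right side is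
increasing in ν where both factors are positive; this gives existence and uniqueness. Asymptotically
there are three regimes: both factors tend to 1 and ν is of order n^{-ℓ} (`ridge_dominated`); S/p
tends to 1 and ν is of order n^{-qα} (`feature_limited`); S/n tends to 1 and ν is of order n^{-α}
(`sample_limited`).

In regions 1, 2 and 4 the order of ν does not involve q, so R of order ν N is already the claim. In
regions 3 and 5 it does, and q is eliminated between R and N: the sum ν^{2r} + S/n is of order
n^{-2rqα} + n^{q-1}, with the second term dominant in region 3 and the first in region 5. -/

/-- `∑_{j ≥ 1} j^{-a} / (j^{-α} + ν)²`. -/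
def powerSum (α a ν : ℝ) : ℝ :=
  ∑' k : ℕ, ((k : ℝ) + 1) ^ (-a) / (((k : ℝ) + 1) ^ (-α) + ν) ^ 2

/-- Bernoulli's inequality for the exponent s + 1 in (0, 1], at the point -1/(y+1). It replaces
comparison with an integral when the sums are telescoped. -/
theorem rpow_telescope_head {s y : ℝ} (hs : -1 < s) (hs0 : s ≤ 0) (hy : 0 ≤ y) :
    (s + 1) * (y + 1) ^ s ≤ (y + 1) ^ (s + 1) - y ^ (s + 1) := by
  have hy1 : 0 < y + 1 := by linarith
  have h := rpow_one_add_le_one_add_mul_self (s := -(y + 1)⁻¹) (p := s + 1)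
    (by have := inv_le_one_of_one_le₀ (show 1 ≤ y + 1 by linarith); linarith)
    (by linarith) (by linarith)
  have e1 : 1 + -(y + 1)⁻¹ = y / (y + 1) := by field_simp; ring
  rw [e1, Real.div_rpow hy hy1.le, div_le_iff₀ (by positivity)] at h
  have e2 : (y + 1) ^ (s + 1) = (y + 1) ^ s * (y + 1) := by
    rw [Real.rpow_add hy1, Real.rpow_one]
  have e3 : (1 + (s + 1) * -(y + 1)⁻¹) * (y + 1) ^ (s + 1)
      = (y + 1) ^ (s + 1) - (s + 1) * (y + 1) ^ s := by
    rw [e2]; field_simp; ring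
  linarith

/-- From log x ≥ 1 - 1/x at x = (y+1)/y, combined with exp t ≥ 1 + t. -/
theorem rpow_telescope_tail {p y : ℝ} (hp : 0 < p) (hy : 0 < y) :
    p * (y + 1) ^ (-(p + 1)) ≤ y ^ (-p) - (y + 1) ^ (-p) := by
  have hy1 : 0 < y + 1 := by linarith
  have h1 : 1 + p * (y + 1)⁻¹ ≤ ((y + 1) / y) ^ p := by
    have hpos : 0 < (y + 1) / y := by positivity
    have hl := Real.one_sub_inv_le_log_of_pos hpos
    have hi : 1 - ((y + 1) / y)⁻¹ = (y + 1)⁻¹ := by field_simp; ring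
    rw [hi] at hl
    rw [Real.rpow_def_of_pos hpos]
    have := Real.add_one_le_exp (Real.log ((y + 1) / y) * p)
    nlinarith [mul_le_mul_of_nonneg_right hl hp.le]
  rw [Real.div_rpow hy1.le hy.le, le_div_iff₀ (by positivity)] at h1
  have e1 : (y + 1) ^ (-(p + 1)) = (y + 1) ^ (-p) * (y + 1)⁻¹ := by
    rw [neg_add, Real.rpow_add hy1, Real.rpow_neg_one]
  have hA : 0 < (y + 1) ^ p := by positivity
  have hB : 0 < y ^ p := by positivity
  rw [e1, Real.rpow_neg hy.le, Real.rpow_neg hy1.le]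
  have : (1 + p * (y + 1)⁻¹) * ((y + 1) ^ p)⁻¹ ≤ (y ^ p)⁻¹ := by
    rw [← div_eq_mul_inv, div_le_iff₀ hA, ← div_eq_inv_mul, le_div_iff₀ hB]
    exact h1
  linarith

theorem sum_range_rpow_le {s : ℝ} (hs : -1 < s) (hs0 : s ≤ 0) (m : ℕ) :
    ∑ k ∈ Finset.range m, ((k : ℝ) + 1) ^ s ≤ (m : ℝ) ^ (s + 1) / (s + 1) := by
  have hs1 : 0 < s + 1 := by linarith
  rw [le_div_iff₀ hs1, Finset.sum_mul]
  calc _ ≤ ∑ k ∈ Finset.range m, (((k + 1 : ℕ) : ℝ) ^ (s + 1) - (k : ℝ) ^ (s + 1)) := by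
        refine Finset.sum_le_sum fun k _ => ?_
        have := rpow_telescope_head hs hs0 (Nat.cast_nonneg k)
        push_cast; linarith
    _ = _ := by
        rw [Finset.sum_range_sub fun k : ℕ => (k : ℝ) ^ (s + 1)]
        simp [Real.zero_rpow hs1.ne']

theorem sum_range_rpow_tail_le {a : ℝ} (ha : 1 < a) {m : ℕ} (hm : 0 < m) (N : ℕ) :
    ∑ k ∈ Finset.range N, (((k + m : ℕ) : ℝ) + 1) ^ (-a) ≤ (m : ℝ) ^ (1 - a) / (a - 1) := by
  have ha1 : 0 < a - 1 := by linarith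
  rw [le_div_iff₀ ha1, Finset.sum_mul]
  calc _ ≤ ∑ k ∈ Finset.range N,
        (((k + m : ℕ) : ℝ) ^ (1 - a) - ((k + 1 + m : ℕ) : ℝ) ^ (1 - a)) := by
        refine Finset.sum_le_sum fun k _ => ?_
        have := rpow_telescope_tail ha1
          (show (0 : ℝ) < ((k + m : ℕ) : ℝ) by exact_mod_cast (by omega))
        rw [sub_add_cancel, neg_sub] at this
        have e : ((k + 1 + m : ℕ) : ℝ) = ((k + m : ℕ) : ℝ) + 1 := by push_cast; ring
        rw [e]; linarith
    _ ≤ _ := by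
        rw [Finset.sum_range_sub' fun k : ℕ => ((k + m : ℕ) : ℝ) ^ (1 - a)]
        have : 0 ≤ ((N + m : ℕ) : ℝ) ^ (1 - a) := by positivity
        simp only [zero_add]; linarith

theorem summable_rpow_succ {a : ℝ} (ha : 1 < a) : Summable fun k : ℕ => ((k : ℝ) + 1) ^ (-a) := by
  have := (summable_nat_add_iff 1).2 (Real.summable_nat_rpow.2 (show -a < -1 by linarith))
  simpa using this

theorem powerSum_term_le {α a ν : ℝ} (hν : 0 < ν) (k : ℕ) :
    ((k : ℝ) + 1) ^ (-a) / (((k : ℝ) + 1) ^ (-α) + ν) ^ 2 ≤ ((k : ℝ) + 1) ^ (-a) / ν ^ 2 := by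
  have : 0 ≤ ((k : ℝ) + 1) ^ (-α) := by positivity
  gcongr; linarith

theorem summable_powerSum (α : ℝ) {a ν : ℝ} (ha : 1 < a) (hν : 0 < ν) :
    Summable fun k : ℕ => ((k : ℝ) + 1) ^ (-a) / (((k : ℝ) + 1) ^ (-α) + ν) ^ 2 :=
  Summable.of_nonneg_of_le (fun _ => by positivity) (powerSum_term_le hν)
    ((summable_rpow_succ ha).div_const _)

/-- The square (y^{-α} + ν)² is split into exponents 2 - β and β, bounding the base below by y^{-α}
in one factor and by ν in the other. The freedom in β allows the power s of y to be prescribed. -/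
theorem rpow_div_le_interpolate {α a s β y ν : ℝ} (hβ : α * β = 2 * α - a - s) (hβ0 : 0 ≤ β)
    (hβ2 : β ≤ 2) (hy : 0 < y) (hν : 0 < ν) :
    y ^ (-a) / (y ^ (-α) + ν) ^ 2 ≤ ν ^ (-β) * y ^ s := by
  have hyα : 0 < y ^ (-α) := by positivity
  have h1 : (y ^ (-α)) ^ (2 - β) * ν ^ β ≤ (y ^ (-α) + ν) ^ 2 := by
    calc _ ≤ (y ^ (-α) + ν) ^ (2 - β) * (y ^ (-α) + ν) ^ β := by
          gcongr <;> linarith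
      _ = _ := by
          rw [← Real.rpow_add (by positivity)]; norm_num
  have e : y ^ (-a) = (ν ^ (-β) * y ^ s) * ((y ^ (-α)) ^ (2 - β) * ν ^ β) := by
    rw [← Real.rpow_mul hy.le]
    calc y ^ (-a) = y ^ (s + -α * (2 - β)) * (ν ^ (-β + β)) := by
          rw [neg_add_cancel, Real.rpow_zero, mul_one]; congr 1; linarith
      _ = _ := by rw [Real.rpow_add hy, Real.rpow_add hν]; ring
  rw [div_le_iff₀ (by positivity), e]
  gcongr

/-- The cutoff index `⌈ν^{-1/α}⌉` is comparable with `ν^{-1/α}`. -/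
theorem cutoff_bounds {α M ν : ℝ} (hα : 0 < α) (hν : 0 < ν) (hνM : ν ≤ M) :
    ∃ m : ℕ, 0 < m ∧ ν ^ (-(1 / α)) ≤ m ∧ (m : ℝ) ≤ (1 + M ^ (1 / α)) * ν ^ (-(1 / α)) := by
  have hx : 0 < ν ^ (-(1 / α)) := by positivity
  refine ⟨⌈ν ^ (-(1 / α))⌉₊, Nat.ceil_pos.2 hx, Nat.le_ceil _, ?_⟩
  have h1 := (Nat.ceil_lt_add_one hx.le).le
  have h2 : 1 ≤ M ^ (1 / α) * ν ^ (-(1 / α)) := by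
    rw [Real.rpow_neg hν.le, ← div_eq_mul_inv, one_le_div (by positivity)]
    gcongr
  linarith

theorem powerSum_le {α a M : ℝ} (hα : 1 < α) (ha : 1 < a) (ha' : a < 2 * α + 1) :
    ∃ C : ℝ, 0 < C ∧ ∀ ν : ℝ, 0 < ν → ν ≤ M →
      powerSum α a ν ≤ C * ν ^ ((a - 1) / α - 2) := by
  rcases le_or_gt M 0 with hM | hM
  · exact ⟨1, one_pos, fun ν h1 h2 => absurd h1 (by linarith)⟩
  have hα0 : 0 < α := by linarith
  -- The natural head exponent is 2α - a. It is cut at 0 because the head telescoping needs s ≤ 0;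
  -- the excess is turned into the factor ν^{-β}. The bound a < 2α + 1 keeps s > -1.
  set s := min 0 (2 * α - a) with hsdef
  have hs0 : s ≤ 0 := min_le_left _ _
  have hs1 : s ≤ 2 * α - a := min_le_right _ _
  have hs : -1 < s := lt_min (by norm_num) (by linarith)
  have hsp : 0 < s + 1 := by linarith
  have ha1 : 0 < a - 1 := by linarith
  set β := (2 * α - a - s) / α with hβdef
  have hβ : α * β = 2 * α - a - s := by rw [hβdef]; field_simp
  have hβ0 : 0 ≤ β := div_nonneg (by linarith) hα0.le
  have hβ2 : β ≤ 2 := by rw [hβdef, div_le_iff₀ hα0]; linarith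
  set K := 1 + M ^ (1 / α) with hK
  have hKpos : 0 < K := by positivity
  refine ⟨K ^ (s + 1) / (s + 1) + 1 / (a - 1), by positivity, fun ν hν hνM => ?_⟩
  obtain ⟨m, hm0, hm1, hm2⟩ := cutoff_bounds hα0 hν hνM
  have hx : 0 < ν ^ (-(1 / α)) := by positivity
  have hsum := summable_powerSum α ha hν
  rw [powerSum, ← hsum.sum_add_tsum_nat_add m, add_mul]
  refine add_le_add ?_ ?_
  · calc _ ≤ ∑ k ∈ Finset.range m, ν ^ (-β) * ((k : ℝ) + 1) ^ s :=
          Finset.sum_le_sum fun k _ =>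
            rpow_div_le_interpolate hβ hβ0 hβ2 (by positivity) hν
      _ ≤ ν ^ (-β) * ((K * ν ^ (-(1 / α))) ^ (s + 1) / (s + 1)) := by
          rw [← Finset.mul_sum]
          gcongr
          refine (sum_range_rpow_le hs hs0 m).trans ?_
          gcongr
      _ = _ := by
          rw [Real.mul_rpow hKpos.le hx.le, ← Real.rpow_mul hν.le]
          have : ν ^ ((a - 1) / α - 2) = ν ^ (-β) * ν ^ (-(1 / α) * (s + 1)) := by
            rw [← Real.rpow_add hν]; congr 1; rw [hβdef]; field_simp; ring
          rw [this]; ring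
  · refine Real.tsum_le_of_sum_range_le (fun _ => by positivity) fun N => ?_
    calc _ ≤ ∑ k ∈ Finset.range N, (((k + m : ℕ) : ℝ) + 1) ^ (-a) / ν ^ 2 :=
          Finset.sum_le_sum fun k _ => powerSum_term_le hν _
      _ ≤ ((ν ^ (-(1 / α))) ^ (1 - a) / (a - 1)) / ν ^ 2 := by
          rw [← Finset.sum_div]
          gcongr
          refine (sum_range_rpow_tail_le ha hm0 N).trans ?_
          gcongr ?_ / _
          exact Real.rpow_le_rpow_of_nonpos hx hm1 (by linarith)
      _ = _ := by
          rw [← Real.rpow_mul hν.le, Real.rpow_sub hν]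
          have : -(1 / α) * (1 - a) = (a - 1) / α := by field_simp; ring
          rw [this, show (2 : ℝ) = ((2 : ℕ) : ℝ) by norm_num, Real.rpow_natCast]; ring

/-- The block of m terms just past the cutoff m already has the full order, since j and ν^{-1/α} are
comparable there. -/
theorem le_powerSum {α a M : ℝ} (hα : 1 < α) (ha : 1 < a) :
    ∃ c : ℝ, 0 < c ∧ ∀ ν : ℝ, 0 < ν → ν ≤ M →
      c * ν ^ ((a - 1) / α - 2) ≤ powerSum α a ν := by
  rcases le_or_gt M 0 with hM | hM
  · exact ⟨1, one_pos, fun ν h1 h2 => absurd h1 (by linarith)⟩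
  have hα0 : 0 < α := by linarith
  set K := 1 + M ^ (1 / α) with hK
  have hKpos : 0 < K := by positivity
  refine ⟨(2 * K) ^ (-a) / 4, by positivity, fun ν hν hνM => ?_⟩
  obtain ⟨m, hm0, hm1, hm2⟩ := cutoff_bounds hα0 hν hνM
  set x := ν ^ (-(1 / α)) with hxdef
  have hx : 0 < x := by positivity
  have hsum := summable_powerSum α ha hν
  have hxα : x ^ (-α) = ν := by
    rw [hxdef, ← Real.rpow_mul hν.le]
    have : -(1 / α) * -α = 1 := by field_simp
    rw [this, Real.rpow_one]
  calc _ = x * ((2 * K * x) ^ (-a) / (2 * ν) ^ 2) := by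
        rw [Real.mul_rpow (by positivity) hx.le]
        have : ν ^ ((a - 1) / α - 2) = x * x ^ (-a) / ν ^ 2 := by
          rw [hxdef, ← Real.rpow_mul hν.le, ← Real.rpow_add hν, Real.rpow_sub hν,
            show (2 : ℝ) = ((2 : ℕ) : ℝ) by norm_num, Real.rpow_natCast]
          congr 2; field_simp; ring
        rw [this]; field_simp; ring
    _ ≤ ∑ k ∈ Finset.range m, (2 * K * x) ^ (-a) / (2 * ν) ^ 2 := by
        rw [Finset.sum_const, Finset.card_range, nsmul_eq_mul]
        gcongr
    -- On this block j = m + k + 1 lies between x and 2m ≤ 2Kx, so j^{-α} ≤ ν and the denominator is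
    -- at most (2ν)².
    _ ≤ ∑ k ∈ Finset.range m,
        (((m + k : ℕ) : ℝ) + 1) ^ (-a) / ((((m + k : ℕ) : ℝ) + 1) ^ (-α) + ν) ^ 2 := by
        refine Finset.sum_le_sum fun k hk => ?_
        have hk' : (k : ℝ) + 1 ≤ m := by exact_mod_cast Finset.mem_range.1 hk
        have hle : ((m + k : ℕ) : ℝ) + 1 ≤ 2 * K * x := by push_cast; linarith
        have hge : x ≤ ((m + k : ℕ) : ℝ) + 1 := by
          push_cast; linarith [(Nat.cast_nonneg k : (0 : ℝ) ≤ k)]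
        have h1 : (2 * K * x) ^ (-a) ≤ (((m + k : ℕ) : ℝ) + 1) ^ (-a) :=
          Real.rpow_le_rpow_of_nonpos (by positivity) hle (by linarith)
        have h2 : (((m + k : ℕ) : ℝ) + 1) ^ (-α) ≤ ν := by
          rw [← hxα]; exact Real.rpow_le_rpow_of_nonpos hx hge (by linarith)
        have h3 : 0 < (((m + k : ℕ) : ℝ) + 1) ^ (-α) := by positivity
        gcongr; linarith
    _ ≤ ∑ k ∈ Finset.range (m + m), ((k : ℝ) + 1) ^ (-a) / (((k : ℝ) + 1) ^ (-α) + ν) ^ 2 := by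
        rw [Finset.sum_range_add]
        exact le_add_of_nonneg_left (Finset.sum_nonneg fun _ _ => by positivity)
    _ ≤ _ := hsum.sum_le_tsum _ fun _ _ => by positivity

open Asymptotics Filter in
theorem isTheta_powerSum {α a M : ℝ} (hα : 1 < α) (ha : 1 < a) (ha' : a < 2 * α + 1)
    {ι : Type*} {l : Filter ι} {ν : ι → ℝ} (hν : ∀ᶠ i in l, 0 < ν i) (hM : ∀ᶠ i in l, ν i ≤ M) :
    (fun i => powerSum α a (ν i)) =Θ[l] fun i => ν i ^ ((a - 1) / α - 2) := by
  obtain ⟨C, hC, h1⟩ := powerSum_le (M := M) hα ha ha'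
  obtain ⟨c, hc, h2⟩ := le_powerSum (M := M) hα ha
  refine ⟨.of_bound C ?_, .of_bound c⁻¹ ?_⟩ <;> filter_upwards [hν, hM] with i hi hi'
  · have h0 : 0 ≤ powerSum α a (ν i) := tsum_nonneg fun _ => by positivity
    rw [Real.norm_of_nonneg h0, Real.norm_of_nonneg (by positivity)]
    exact h1 _ hi hi'
  · have h0 : 0 ≤ powerSum α a (ν i) := tsum_nonneg fun _ => by positivity
    rw [Real.norm_of_nonneg h0, Real.norm_of_nonneg (by positivity), ← div_eq_inv_mul,
      le_div_iff₀ hc, mul_comm]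
    exact h2 _ hi hi'

end RFM

end

/-! ### Degrees of freedom and unique solvability of the self-consistent equations. -/

noncomputable section

namespace RFM

theorem powerSpectrum_pos (α : ℝ) (k : ℕ) : 0 < powerSpectrum α k := by
  unfold powerSpectrum; positivity

theorem summable_powerSpectrum {α : ℝ} (hα : 1 < α) : Summable (powerSpectrum α) :=
  summable_rpow_succ hα

theorem df2_powerSpectrum (α ν : ℝ) : df2 (powerSpectrum α) ν = powerSum α (2 * α) ν := by
  refine tsum_congr fun k => ?_
  have hk : (0 : ℝ) < (k : ℝ) + 1 := by positivity
  rw [powerSpectrum, pow_two (_ ^ (-α)), ← Real.rpow_add hk]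
  congr 2; ring

theorem powerTarget_sq (α r : ℝ) (k : ℕ) :
    powerTarget α r k ^ 2 = ((k : ℝ) + 1) ^ (-(1 + 2 * α * r)) := by
  have hk : (0 : ℝ) < (k : ℝ) + 1 := by positivity
  rw [powerTarget, pow_two, ← Real.rpow_add hk]
  congr 1; ring

theorem quad0_power (α r ν : ℝ) :
    quad0 (powerSpectrum α) (powerTarget α r) ν = powerSum α (1 + 2 * α * r) ν :=
  tsum_congr fun k => by rw [powerTarget_sq, powerSpectrum]

theorem quad1_power (α r ν : ℝ) :
    quad1 (powerSpectrum α) (powerTarget α r) ν = powerSum α (1 + 2 * α * r + α) ν := by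
  refine tsum_congr fun k => ?_
  have hk : (0 : ℝ) < (k : ℝ) + 1 := by positivity
  rw [powerTarget_sq, powerSpectrum, ← Real.rpow_add hk]
  congr 2; ring

theorem df1_term_le {Λ : ℕ → ℝ} (hΛ : ∀ k, 0 < Λ k) {δ ν : ℝ} (hδ : 0 < δ) (hν : δ ≤ ν) (k : ℕ) :
    Λ k / (Λ k + ν) ≤ Λ k / δ :=
  div_le_div_of_nonneg_left (hΛ k).le hδ (by linarith [hΛ k])

theorem df1_term_nonneg {Λ : ℕ → ℝ} (hΛ : ∀ k, 0 < Λ k) {ν : ℝ} (hν : 0 < ν) (k : ℕ) :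
    0 ≤ Λ k / (Λ k + ν) :=
  div_nonneg (hΛ k).le (by linarith [hΛ k])

theorem summable_df1 {Λ : ℕ → ℝ} (hΛ : ∀ k, 0 < Λ k) (hs : Summable Λ) {ν : ℝ} (hν : 0 < ν) :
    Summable fun k => Λ k / (Λ k + ν) :=
  Summable.of_nonneg_of_le (df1_term_nonneg hΛ hν) (df1_term_le hΛ hν le_rfl) (hs.div_const _)

theorem df1_le {Λ : ℕ → ℝ} (hΛ : ∀ k, 0 < Λ k) (hs : Summable Λ) {ν : ℝ} (hν : 0 < ν) :
    df1 Λ ν ≤ (∑' k, Λ k) / ν := by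
  rw [df1, ← tsum_div_const]
  exact (summable_df1 hΛ hs hν).tsum_le_tsum (df1_term_le hΛ hν le_rfl) (hs.div_const _)

theorem df1_strictAntiOn {Λ : ℕ → ℝ} (hΛ : ∀ k, 0 < Λ k) (hs : Summable Λ) :
    StrictAntiOn (df1 Λ) (Set.Ioi 0) := by
  intro μ hμ ν hν h
  rw [Set.mem_Ioi] at hμ hν
  refine (summable_df1 hΛ hs hν).tsum_lt_tsum (i := 0) (fun k => ?_) ?_ (summable_df1 hΛ hs hμ)
  · exact div_le_div_of_nonneg_left (hΛ k).le (by linarith [hΛ k]) (by linarith)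
  · exact div_lt_div_of_pos_left (hΛ 0) (by linarith [hΛ 0]) (by linarith)

theorem df1_continuousOn {Λ : ℕ → ℝ} (hΛ : ∀ k, 0 < Λ k) (hs : Summable Λ) {δ : ℝ} (hδ : 0 < δ) :
    ContinuousOn (df1 Λ) (Set.Ici δ) := by
  refine continuousOn_tsum (u := fun k => Λ k / δ) (fun k => ?_) (hs.div_const _) fun k ν hν => ?_
  · refine continuousOn_const.div (by fun_prop) fun ν hν => ?_
    have := hΛ k
    rw [Set.mem_Ici] at hν
    linarith
  · rw [Set.mem_Ici] at hν
    rw [Real.norm_of_nonneg (df1_term_nonneg hΛ (hδ.trans_le hν) k)]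
    exact df1_term_le hΛ hδ hν k

/-- Once ε is below the first N ≥ 2B eigenvalues, each of them contributes at least 1/2. -/
theorem exists_le_df1 {Λ : ℕ → ℝ} (hΛ : ∀ k, 0 < Λ k) (hs : Summable Λ) (B : ℝ) :
    ∃ ε : ℝ, 0 < ε ∧ B ≤ df1 Λ ε := by
  obtain ⟨N, hN⟩ := exists_nat_ge (2 * B)
  obtain ⟨ε, hε, h⟩ : ∃ ε : ℝ, 0 < ε ∧ ∀ k ∈ Finset.range N, ε ≤ Λ k := by
    rcases (Finset.range N).eq_empty_or_nonempty with h | h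
    · exact ⟨1, one_pos, by simp [h]⟩
    · obtain ⟨i, _, hi⟩ := Finset.exists_min_image _ Λ h
      exact ⟨Λ i, hΛ i, hi⟩
  refine ⟨ε, hε, ?_⟩
  calc B ≤ ∑ k ∈ Finset.range N, (1 / 2 : ℝ) := by
        rw [Finset.sum_const, Finset.card_range, nsmul_eq_mul]; linarith
    _ ≤ ∑ k ∈ Finset.range N, Λ k / (Λ k + ε) := by
        refine Finset.sum_le_sum fun k hk => ?_
        have := h k hk
        rw [div_le_div_iff₀ two_pos (by linarith [hΛ k])]; linarith
    _ ≤ _ := (summable_df1 hΛ hs hε).sum_le_tsum _ fun k _ => df1_term_nonneg hΛ hε k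

theorem df1_pos {Λ : ℕ → ℝ} (hΛ : ∀ k, 0 < Λ k) (hs : Summable Λ) {ν : ℝ} (hν : 0 < ν) :
    0 < df1 Λ ν :=
  (summable_df1 hΛ hs hν).tsum_pos (df1_term_nonneg hΛ hν) 0
    (div_pos (hΛ 0) (by linarith [hΛ 0]))

/-- The self-consistent equations, solved for `ν₁` and `lam`. -/
theorem selfConsistent_iff {Λ : ℕ → ℝ} {n p lam ν₁ ν₂ : ℝ} (hp : 0 < p) (hlam : 0 < lam) :
    SelfConsistent Λ n p lam ν₁ ν₂ ↔ 0 < ν₂ ∧ df1 Λ ν₂ < p ∧ df1 Λ ν₂ < n ∧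
      ν₁ = ν₂ * (1 - df1 Λ ν₂ / p) ∧ lam = ν₂ * (1 - df1 Λ ν₂ / p) * (n - df1 Λ ν₂) := by
  constructor
  · rintro ⟨h1, h2, h3, h4⟩
    have e1 : ν₁ = ν₂ * (1 - df1 Λ ν₂ / p) := by rw [← h4]; field_simp; ring
    have e2 : lam = ν₁ * (n - df1 Λ ν₂) := by rw [← h3]; field_simp; ring
    refine ⟨h2, ?_, ?_, e1, by rw [← e1]; exact e2⟩
    · have : 0 < p * ν₁ / ν₂ := by positivity
      linarith
    · have : 0 < lam / ν₁ := by positivity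
      linarith
  · rintro ⟨h2, h3, h4, h5, h6⟩
    have h7 : 0 < 1 - df1 Λ ν₂ / p := by rw [sub_pos, div_lt_one hp]; exact h3
    have h8 : 0 < n - df1 Λ ν₂ := by linarith
    have h1 : 0 < ν₁ := by rw [h5]; positivity
    refine ⟨h1, h2, ?_, ?_⟩
    · rw [h6, ← h5]; field_simp; ring
    · rw [h5]; field_simp; ring

theorem existsUnique_selfConsistent {Λ : ℕ → ℝ} (hΛ : ∀ k, 0 < Λ k) (hs : Summable Λ)
    {n p lam : ℝ} (hn : 0 < n) (hp : 0 < p) (hlam : 0 < lam) :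
    ∃! ν : ℝ × ℝ, SelfConsistent Λ n p lam ν.1 ν.2 := by
  have hanti := df1_strictAntiOn hΛ hs
  obtain ⟨ε, hε, hεn⟩ := exists_le_df1 hΛ hs n
  set Z := ∑' k, Λ k with hZ
  have hZ0 : 0 ≤ Z := tsum_nonneg fun k => (hΛ k).le
  -- Truncating both factors at 0 prevents a product of two negative factors from giving a spurious
  -- solution. A point where g equals `lam` > 0 then has both factors positive.
  set g : ℝ → ℝ := fun ν => ν * max (1 - df1 Λ ν / p) 0 * max (n - df1 Λ ν) 0 with hg
  -- The middle terms force `df1 Λ T` ≤ p/2 and ≤ n/2; the last then gives g(T) ≥ T · (1/2) · (n/2)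
  -- ≥ `lam`.
  set T := ε + 2 * Z / p + 2 * Z / n + 4 * lam / n with hT
  have hTε : ε ≤ T := by
    have : 0 ≤ 2 * Z / p + 2 * Z / n + 4 * lam / n := by positivity
    linarith
  have hT0 : 0 < T := hε.trans_le hTε
  have hcont : ContinuousOn g (Set.Icc ε T) := by
    have h := (df1_continuousOn hΛ hs hε).mono (fun x (hx : x ∈ Set.Icc ε T) => hx.1)
    have h1 : ContinuousOn (fun ν => max (1 - df1 Λ ν / p) 0) (Set.Icc ε T) :=
      (continuousOn_const.sub (h.div_const p)).sup continuousOn_const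
    have h2 : ContinuousOn (fun ν => max (n - df1 Λ ν) 0) (Set.Icc ε T) :=
      (continuousOn_const.sub h).sup continuousOn_const
    exact (continuousOn_id.mul h1).mul h2
  have hgε : g ε ≤ lam := by
    have : max (n - df1 Λ ε) 0 = 0 := max_eq_right (by linarith)
    simp only [hg, this, mul_zero]; exact hlam.le
  have hgT : lam ≤ g T := by
    have hS := df1_le hΛ hs hT0
    have hSp : df1 Λ T ≤ p / 2 := by
      refine hS.trans ?_
      rw [div_le_iff₀ hT0]
      have : 2 * Z / p ≤ T := by
        have : 0 ≤ 2 * Z / n + 4 * lam / n := by positivity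
        linarith
      rw [div_le_iff₀ hp] at this; linarith
    have hSn : df1 Λ T ≤ n / 2 := by
      refine hS.trans ?_
      rw [div_le_iff₀ hT0]
      have : 2 * Z / n ≤ T := by
        have : 0 ≤ 2 * Z / p + 4 * lam / n := by positivity
        linarith
      rw [div_le_iff₀ hn] at this; linarith
    have h1 : 1 / 2 ≤ max (1 - df1 Λ T / p) 0 := by
      refine le_max_of_le_left ?_
      have : df1 Λ T / p ≤ 1 / 2 := by rw [div_le_iff₀ hp]; linarith
      linarith
    have h2 : n / 2 ≤ max (n - df1 Λ T) 0 := le_max_of_le_left (by linarith)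
    have h3 : 4 * lam / n ≤ T := by
      have : 0 ≤ 2 * Z / p + 2 * Z / n := by positivity
      linarith
    calc lam = 4 * lam / n * (1 / 2) * (n / 2) := by field_simp; norm_num
      _ ≤ g T := by simp only [hg]; gcongr
  obtain ⟨ν, hν, hgν⟩ := intermediate_value_Icc hTε hcont ⟨hgε, hgT⟩
  have hν0 : 0 < ν := hε.trans_le hν.1
  have hne : g ν ≠ 0 := by rw [hgν]; exact hlam.ne'
  have h1 : 0 < 1 - df1 Λ ν / p := by
    by_contra! h
    exact hne (by simp [hg, max_eq_right h])
  have h2 : 0 < n - df1 Λ ν := by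
    by_contra! h
    exact hne (by simp only [hg]; rw [max_eq_right h, mul_zero])
  refine ⟨(ν * (1 - df1 Λ ν / p), ν), ?_, ?_⟩
  · refine (selfConsistent_iff hp hlam).2 ⟨hν0, ?_, by linarith, rfl, ?_⟩
    · rwa [sub_pos, div_lt_one hp] at h1
    · rw [← hgν]; simp only [hg]; rw [max_eq_left h1.le, max_eq_left h2.le]
  -- Where both factors are positive, all three factors increase with μ, since `df1` decreases.
  · have key : ∀ {μ μ' : ℝ}, 0 < μ → μ < μ' → df1 Λ μ < p → df1 Λ μ < n →
        μ * (1 - df1 Λ μ / p) * (n - df1 Λ μ) < μ' * (1 - df1 Λ μ' / p) * (n - df1 Λ μ') := by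
      intro μ μ' hμ hlt hμp hμn
      have hS := hanti hμ (hμ.trans hlt) hlt
      have h1 : 0 < 1 - df1 Λ μ / p := by rw [sub_pos, div_lt_one hp]; exact hμp
      have h2 : 0 < n - df1 Λ μ := by linarith
      have h3 : df1 Λ μ' / p < df1 Λ μ / p := by gcongr
      gcongr
    rintro ⟨μ₁, μ⟩ hμ
    obtain ⟨hμ0, hμp, hμn, hμ₁, hμl⟩ := (selfConsistent_iff hp hlam).1 hμ
    dsimp only at hμ0 hμp hμn hμ₁ hμl
    have hνl : lam = ν * (1 - df1 Λ ν / p) * (n - df1 Λ ν) := by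
      rw [← hgν]; simp only [hg]; rw [max_eq_left h1.le, max_eq_left h2.le]
    have : μ = ν := by
      rcases lt_trichotomy μ ν with h | h | h
      · have := key hμ0 h hμp hμn; linarith
      · exact h
      · have := key hν0 h (by rwa [sub_pos, div_lt_one hp] at h1) (by linarith); linarith
    rw [hμ₁, this]

theorem df1_eq {α : ℝ} (hα : 1 < α) {ν : ℝ} (hν : 0 < ν) :
    df1 (powerSpectrum α) ν = df2 (powerSpectrum α) ν + ν * trRes2 (powerSpectrum α) ν := by
  have h2 : Summable fun k => powerSpectrum α k ^ 2 / (powerSpectrum α k + ν) ^ 2 :=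
    Summable.of_nonneg_of_le (fun _ => by positivity)
      (fun k => by
        have := powerSpectrum_pos α k
        rw [← div_pow, pow_two]
        refine mul_le_of_le_one_right (df1_term_nonneg (powerSpectrum_pos α) hν k) ?_
        rw [div_le_one (by linarith)]; linarith)
      (summable_df1 (powerSpectrum_pos α) (summable_powerSpectrum hα) hν)
  have h3 : Summable fun k => powerSpectrum α k / (powerSpectrum α k + ν) ^ 2 :=
    summable_powerSum α hα hν
  rw [df1, df2, trRes2, ← tsum_mul_left, ← h2.tsum_add (h3.mul_left ν)]
  refine tsum_congr fun k => ?_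
  have := powerSpectrum_pos α k
  have : powerSpectrum α k + ν ≠ 0 := by linarith
  field_simp

end RFM

end

/-! ### Orders of Υ, χ, the risk and the norm in terms of ν₂. -/

noncomputable section

namespace RFM

open Asymptotics Filter Topology

section Theta

variable {ι : Type*} {l : Filter ι}

theorem isTheta_of_bounds {f g : ι → ℝ} {c C : ℝ} (hc : 0 < c) (hg : ∀ᶠ i in l, 0 ≤ g i)
    (h1 : ∀ᶠ i in l, c * g i ≤ f i) (h2 : ∀ᶠ i in l, f i ≤ C * g i) : f =Θ[l] g := by
  refine ⟨.of_bound C ?_, .of_bound c⁻¹ ?_⟩ <;> filter_upwards [hg, h1, h2] with i hi hi1 hi2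
  · have : 0 ≤ c * g i := by positivity
    rwa [Real.norm_of_nonneg (this.trans hi1), Real.norm_of_nonneg hi]
  · have : 0 ≤ c * g i := by positivity
    rw [Real.norm_of_nonneg (this.trans hi1), Real.norm_of_nonneg hi, ← div_eq_inv_mul,
      le_div_iff₀ hc, mul_comm]
    exact hi1

theorem isBigO_of_le_of_nonneg {f g : ι → ℝ} (hf : ∀ᶠ i in l, 0 ≤ f i) (h : ∀ᶠ i in l, f i ≤ g i) :
    f =O[l] g := by
  refine .of_bound 1 ?_
  filter_upwards [hf, h] with i h1 h2
  rwa [one_mul, Real.norm_of_nonneg h1, Real.norm_of_nonneg (h1.trans h2)]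

theorem isTheta_add_of_nonneg {f₁ f₂ g₁ g₂ : ι → ℝ} (h₁ : f₁ =Θ[l] g₁) (h₂ : f₂ =Θ[l] g₂)
    (hf₁ : ∀ᶠ i in l, 0 ≤ f₁ i) (hf₂ : ∀ᶠ i in l, 0 ≤ f₂ i)
    (hg₁ : ∀ᶠ i in l, 0 ≤ g₁ i) (hg₂ : ∀ᶠ i in l, 0 ≤ g₂ i) :
    (fun i => f₁ i + f₂ i) =Θ[l] fun i => g₁ i + g₂ i := by
  have key : ∀ {u₁ u₂ v₁ v₂ : ι → ℝ}, u₁ =O[l] v₁ → u₂ =O[l] v₂ → (∀ᶠ i in l, 0 ≤ v₁ i) →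
      (∀ᶠ i in l, 0 ≤ v₂ i) → (fun i => u₁ i + u₂ i) =O[l] fun i => v₁ i + v₂ i := by
    intro u₁ u₂ v₁ v₂ h1 h2 hv1 hv2
    refine (h1.trans (isBigO_of_le_of_nonneg hv1 ?_)).add
      (h2.trans (isBigO_of_le_of_nonneg hv2 ?_)) <;> filter_upwards [hv1, hv2] with i _ _
    all_goals linarith
  exact ⟨key h₁.1 h₂.1 hg₁ hg₂, key h₁.2 h₂.2 hf₁ hf₂⟩

theorem isTheta_one_of_tendsto {f : ι → ℝ} (h : Tendsto f l (𝓝 1)) :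
    f =Θ[l] fun _ => (1 : ℝ) :=
  (isTheta_of_div_tendsto_nhds_ne_zero (c := (1 : ℝ)) (by simpa [Pi.div_def] using h)
    one_ne_zero).symm

end Theta

section Identities

variable {T D p n : ℝ}

/-- Here S/p stands for 1 - ν₁/ν₂. In this form Υ can be compared directly with T/n and S/n. -/
theorem Upsilon_identity {S : ℝ} (hS : S = T + D) (hp : 0 < p) (hT : T < p) :
    p / n * ((S / p) ^ 2 + (1 - S / p) ^ 2 * (T / (p - T))) = (T + D ^ 2 / (p - T)) / n := by
  have h : p - T ≠ 0 := by linarith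
  rw [div_mul_eq_mul_div]
  congr 1
  subst hS
  field_simp
  ring

end Identities

section Asymp

variable {ι : Type*} {l : Filter ι} {α M : ℝ} {ν : ι → ℝ}

theorem isTheta_df (hα : 1 < α) (hν : ∀ᶠ i in l, 0 < ν i) (hM : ∀ᶠ i in l, ν i ≤ M) :
    ((fun i => df1 (powerSpectrum α) (ν i)) =Θ[l] fun i => ν i ^ (-(1 / α))) ∧
    ((fun i => df2 (powerSpectrum α) (ν i)) =Θ[l] fun i => df1 (powerSpectrum α) (ν i)) ∧
    ((fun i => ν i * trRes2 (powerSpectrum α) (ν i)) =Θ[l]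
      fun i => df1 (powerSpectrum α) (ν i)) := by
  have hα0 : 0 < α := by linarith
  have hT : (fun i => df2 (powerSpectrum α) (ν i)) =Θ[l] fun i => ν i ^ (-(1 / α)) := by
    have h := isTheta_powerSum (a := 2 * α) hα (by linarith) (by linarith) hν hM
    have e : (2 * α - 1) / α - 2 = -(1 / α) := by field_simp; ring
    simpa only [e, df2_powerSpectrum] using h
  have hD : (fun i => ν i * trRes2 (powerSpectrum α) (ν i)) =Θ[l] fun i => ν i ^ (-(1 / α)) := by
    have h := (isTheta_refl ν l).mul
      (isTheta_powerSum (a := α) hα (by linarith) (by linarith) hν hM)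
    refine h.trans_eventuallyEq ?_
    filter_upwards [hν] with i hi
    have e : -(1 / α) = 1 + ((α - 1) / α - 2) := by field_simp; ring
    rw [e, Real.rpow_add hi, Real.rpow_one]
  have hS : (fun i => df1 (powerSpectrum α) (ν i)) =ᶠ[l]
      fun i => df2 (powerSpectrum α) (ν i) + ν i * trRes2 (powerSpectrum α) (ν i) := by
    filter_upwards [hν] with i hi using df1_eq hα hi
  have hT0 : ∀ i, 0 ≤ df2 (powerSpectrum α) (ν i) := fun i => tsum_nonneg fun k => by positivity
  have hD0 : ∀ᶠ i in l, 0 ≤ ν i * trRes2 (powerSpectrum α) (ν i) := by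
    filter_upwards [hν] with i hi
    exact mul_nonneg hi.le
      (tsum_nonneg fun k => div_nonneg (powerSpectrum_pos α k).le (by positivity))
  have hSx : (fun i => df1 (powerSpectrum α) (ν i)) =Θ[l] fun i => ν i ^ (-(1 / α)) := by
    refine ⟨hS.trans_isBigO (hT.1.add hD.1), hT.2.trans (isBigO_of_le_of_nonneg (.of_forall hT0) ?_)⟩
    filter_upwards [hS, hD0] with i h1 h2
    linarith
  exact ⟨hSx, hT.trans hSx.symm, hD.trans hSx.symm⟩

theorem isTheta_quad0 {r : ℝ} (hα : 1 < α) (hr₀ : 0 < r) (hr₁ : r < 1 / 2)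
    (hν : ∀ᶠ i in l, 0 < ν i) (hM : ∀ᶠ i in l, ν i ≤ M) :
    (fun i => quad0 (powerSpectrum α) (powerTarget α r) (ν i)) =Θ[l]
      fun i => ν i ^ (2 * r) / ν i ^ 2 := by
  have hα0 : 0 < α := by linarith
  have h := isTheta_powerSum (a := 1 + 2 * α * r) hα (by nlinarith) (by nlinarith) hν hM
  simp only [quad0_power]
  refine h.trans_eventuallyEq ?_
  filter_upwards [hν] with i hi
  have e : (1 + 2 * α * r - 1) / α - 2 = 2 * r - (2 : ℕ) := by push_cast; field_simp; ring
  rw [e, Real.rpow_sub hi, Real.rpow_natCast]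

theorem isTheta_quad1 {r : ℝ} (hα : 1 < α) (hr₀ : 0 < r) (hr₁ : r < 1 / 2)
    (hν : ∀ᶠ i in l, 0 < ν i) (hM : ∀ᶠ i in l, ν i ≤ M) :
    (fun i => quad1 (powerSpectrum α) (powerTarget α r) (ν i)) =Θ[l]
      fun i => ν i ^ (2 * r) / ν i := by
  have hα0 : 0 < α := by linarith
  -- The requirement a < 2α + 1 is exactly r < 1/2.
  have h := isTheta_powerSum (a := 1 + 2 * α * r + α) hα (by nlinarith) (by nlinarith) hν hM
  simp only [quad1_power]
  refine h.trans_eventuallyEq ?_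
  filter_upwards [hν] with i hi
  have e : (1 + 2 * α * r + α - 1) / α - 2 = 2 * r - 1 := by field_simp; ring
  rw [e, Real.rpow_sub hi, Real.rpow_one]

end Asymp

/-- Consequences of the self-consistent equations for the power-law spectrum: the formula for `Υ`
in terms of the degrees of freedom, and the bounds on all quantities involved. -/
theorem selfConsistent_facts {α n p lam ν₁ ν₂ : ℝ} (hα : 1 < α) (hn : 0 < n) (hp : 0 < p)
    (hlam : 0 < lam) (h : SelfConsistent (powerSpectrum α) n p lam ν₁ ν₂) :
    0 < ν₂ ∧ 0 < df2 (powerSpectrum α) ν₂ ∧ 0 < trRes2 (powerSpectrum α) ν₂ ∧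
    df1 (powerSpectrum α) ν₂ < p ∧ df1 (powerSpectrum α) ν₂ < n ∧
    df1 (powerSpectrum α) ν₂ = df2 (powerSpectrum α) ν₂ + ν₂ * trRes2 (powerSpectrum α) ν₂ ∧
    lam = ν₂ * (1 - df1 (powerSpectrum α) ν₂ / p) * (n - df1 (powerSpectrum α) ν₂) ∧
    df2 (powerSpectrum α) ν₂ / n ≤ Upsilon (powerSpectrum α) n p ν₁ ν₂ ∧
    Upsilon (powerSpectrum α) n p ν₁ ν₂ ≤ df1 (powerSpectrum α) ν₂ / n ∧
    ν₂ * trRes2 (powerSpectrum α) ν₂ / n * (1 - df1 (powerSpectrum α) ν₂ / p) ≤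
      1 - Upsilon (powerSpectrum α) n p ν₁ ν₂ := by
  obtain ⟨hν, hSp, hSn, h1, h2⟩ := (selfConsistent_iff hp hlam).1 h
  have hS := df1_eq hα hν
  have hT0 : 0 < df2 (powerSpectrum α) ν₂ := by
    rw [df2_powerSpectrum]
    exact (summable_powerSum α (by linarith) hν).tsum_pos (fun _ => by positivity) 0
      (by positivity)
  have hW0 : 0 < trRes2 (powerSpectrum α) ν₂ :=
    (summable_powerSum α hα hν).tsum_pos (fun _ => by positivity) 0 (by positivity)
  have hD0 : 0 < ν₂ * trRes2 (powerSpectrum α) ν₂ := by positivity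
  have hU : Upsilon (powerSpectrum α) n p ν₁ ν₂ = (df2 (powerSpectrum α) ν₂ +
      (ν₂ * trRes2 (powerSpectrum α) ν₂) ^ 2 / (p - df2 (powerSpectrum α) ν₂)) / n := by
    rw [← Upsilon_identity hS hp (by linarith), Upsilon, h1, mul_div_cancel_left₀ _ hν.ne',
      sub_sub_cancel]
  set S := df1 (powerSpectrum α) ν₂
  set T := df2 (powerSpectrum α) ν₂
  set D := ν₂ * trRes2 (powerSpectrum α) ν₂
  have hpT : 0 < p - T := by linarith
  refine ⟨hν, hT0, hW0, hSp, hSn, hS, h2, ?_, ?_, ?_⟩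
  · rw [hU]; gcongr
    exact le_add_of_nonneg_right (by positivity)
  · rw [hU]; gcongr
    -- D ≤ p - T because p - T = (p - S) + D and S < p.
    have : D ^ 2 / (p - T) ≤ D := by rw [div_le_iff₀ hpT]; nlinarith
    linarith
  · rw [hU, div_mul_eq_mul_div, one_sub_div hn.ne']
    gcongr
    -- As S < n, the numerator of 1 - Υ exceeds S - T - D²/(p - T) = D(p - S)/(p - T), and p - T ≤
    -- p.
    have h3 : (p - S) / p ≤ (p - S) / (p - T) := by
      apply div_le_div_of_nonneg_left <;> linarith
    have h4 : D * (p - S) / (p - T) = D - D ^ 2 / (p - T) := by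
      rw [hS]; field_simp; ring
    calc D * (1 - S / p) = D * ((p - S) / p) := by rw [one_sub_div hp.ne']
      _ ≤ D * ((p - S) / (p - T)) := by gcongr
      _ = D - D ^ 2 / (p - T) := by rw [← h4, mul_div_assoc]
      _ ≤ _ := by linarith

/-- If `1 - Υ` stays away from zero, then `R` and `ν₂ N` are both of the order
`ν₂^{2r} + Tr(Λ(Λ+ν₂)⁻¹) / n`. -/
theorem isTheta_detRisk_detNorm {ι : Type*} {l : Filter ι} {α r σ M : ℝ} (hα : 1 < α)
    (hr₀ : 0 < r) (hr₁ : r < 1 / 2) (hσ : σ ≠ 0) {n p lam ν₁ ν₂ : ι → ℝ}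
    (hn : ∀ᶠ i in l, 0 < n i) (hp : ∀ᶠ i in l, 0 < p i) (hlam : ∀ᶠ i in l, 0 < lam i)
    (hsc : ∀ᶠ i in l, SelfConsistent (powerSpectrum α) (n i) (p i) (lam i) (ν₁ i) (ν₂ i))
    (hM : ∀ᶠ i in l, ν₂ i ≤ M)
    (hU : (fun i => 1 - Upsilon (powerSpectrum α) (n i) (p i) (ν₁ i) (ν₂ i)) =Θ[l]
      fun _ => (1 : ℝ)) :
    ((fun i => detRisk (powerSpectrum α) (powerTarget α r) σ (n i) (p i) (ν₁ i) (ν₂ i)) =Θ[l]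
      fun i => ν₂ i ^ (2 * r) + df1 (powerSpectrum α) (ν₂ i) / n i) ∧
    ((fun i => ν₂ i * detNorm (powerSpectrum α) (powerTarget α r) σ (n i) (p i) (ν₁ i) (ν₂ i))
      =Θ[l] fun i => ν₂ i ^ (2 * r) + df1 (powerSpectrum α) (ν₂ i) / n i) ∧
    ∀ᶠ i in l, 0 ≤ detNorm (powerSpectrum α) (powerTarget α r) σ (n i) (p i) (ν₁ i) (ν₂ i) := by
  have hfacts := (hn.and (hp.and (hlam.and hsc))).mono fun i h =>
    And.intro h.1 (And.intro h.2.1 (selfConsistent_facts hα h.1 h.2.1 h.2.2.1 h.2.2.2))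
  have hν : ∀ᶠ i in l, 0 < ν₂ i := hfacts.mono fun i h => h.2.2.1
  obtain ⟨-, hT, hD⟩ := isTheta_df hα hν hM
  have hQ0 := isTheta_quad0 hα hr₀ hr₁ hν hM
  have hQ1 := isTheta_quad1 hα hr₀ hr₁ hν hM
  have hQ0' : ∀ i, 0 ≤ quad0 (powerSpectrum α) (powerTarget α r) (ν₂ i) :=
    fun i => tsum_nonneg fun k => by positivity
  have hQ1' : ∀ i, 0 ≤ quad1 (powerSpectrum α) (powerTarget α r) (ν₂ i) :=
    fun i => tsum_nonneg fun k => div_nonneg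
      (mul_nonneg (powerSpectrum_pos α k).le (sq_nonneg _)) (by positivity)
  set Q0 : ι → ℝ := fun i => quad0 (powerSpectrum α) (powerTarget α r) (ν₂ i)
  set Q1 : ι → ℝ := fun i => quad1 (powerSpectrum α) (powerTarget α r) (ν₂ i)
  set S : ι → ℝ := fun i => df1 (powerSpectrum α) (ν₂ i)
  set T : ι → ℝ := fun i => df2 (powerSpectrum α) (ν₂ i)
  set W : ι → ℝ := fun i => trRes2 (powerSpectrum α) (ν₂ i)
  set U : ι → ℝ := fun i => Upsilon (powerSpectrum α) (n i) (p i) (ν₁ i) (ν₂ i)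
  have hS0 : ∀ᶠ i in l, 0 < S i :=
    hν.mono fun i h => df1_pos (powerSpectrum_pos α) (summable_powerSpectrum hα) h
  have hU1 : ∀ᶠ i in l, 0 < 1 - U i := by
    filter_upwards [hfacts] with i ⟨h1, h2, h3, h4, h5, h6, h7, h8, h9, h10, h11, h12⟩
    have : S i / n i < 1 := by rwa [div_lt_one h1]
    linarith
  have hU0 : ∀ᶠ i in l, 0 < U i := by
    filter_upwards [hfacts] with i ⟨h1, h2, h3, h4, h5, h6, h7, h8, h9, h10, h11, h12⟩
    exact (div_pos h4 h1).trans_le h10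
  have hpT0 : ∀ᶠ i in l, 0 < p i - T i := by
    filter_upwards [hfacts] with i ⟨h1, h2, h3, h4, h5, h6, h7, h8, h9, h10, h11, h12⟩
    have : 0 < ν₂ i * W i := mul_pos h3 h5
    simp only [T, S, W] at *; linarith
  -- Even when S/p tends to 1 there is no cancellation: p - T = (p - S) + D, a sum of non-negative
  -- terms, and D is of order S.
  have hpT : (fun i => p i - T i) =Θ[l] p := by
    have h : (fun i => (p i - S i) + ν₂ i * W i) =Θ[l] fun i => (p i - S i) + S i := by
      refine isTheta_add_of_nonneg (isTheta_refl _ _) hD ?_ ?_ ?_ (hS0.mono fun _ h => h.le) <;>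
      filter_upwards [hfacts] with i ⟨h1, h2, h3, h4, h5, h6, h7, h8, h9, h10, h11, h12⟩
      · exact sub_nonneg.2 h6.le
      · exact mul_nonneg h3.le h5.le
      · exact sub_nonneg.2 h6.le
    have h' : (fun i => p i - T i) =ᶠ[l] fun i => (p i - S i) + ν₂ i * W i := by
      filter_upwards [hfacts] with i ⟨h1, h2, h3, h4, h5, h6, h7, h8, h9, h10, h11, h12⟩
      simp only [T, S, W]; linarith
    simpa using h'.trans_isTheta h
  have hW : W =Θ[l] fun i => S i / ν₂ i := by
    have h := hD.div (isTheta_refl ν₂ l)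
    have h' : W =ᶠ[l] fun i => ν₂ i * W i / ν₂ i := by
      filter_upwards [hν] with i hi
      field_simp
    exact h'.trans_isTheta h
  have hχ : (fun i => W i / (p i - T i)) =Θ[l] fun i => S i / ν₂ i / p i := hW.div hpT
  have hW0 : ∀ᶠ i in l, 0 < W i := hfacts.mono fun i h => h.2.2.2.2.1
  have hχ0 : ∀ᶠ i in l, 0 < W i / (p i - T i) := by
    filter_upwards [hW0, hpT0] with i h1 h2 using div_pos h1 h2
  have hUΘ : U =Θ[l] fun i => S i / n i := by
    constructor
    · refine isBigO_of_le_of_nonneg (hU0.mono fun _ h => h.le) ?_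
      filter_upwards [hfacts] with i ⟨h1, h2, h3, h4, h5, h6, h7, h8, h9, h10, h11, h12⟩ using h11
    · refine (hT.symm.div (isTheta_refl n l)).1.trans (isBigO_of_le_of_nonneg ?_ ?_) <;>
      filter_upwards [hfacts] with i ⟨h1, h2, h3, h4, h5, h6, h7, h8, h9, h10, h11, h12⟩
      · exact (div_pos h4 h1).le
      · exact h10
  set B : ι → ℝ := fun i =>
    biasR (powerSpectrum α) (powerTarget α r) (n i) (p i) (ν₁ i) (ν₂ i)
  have hBdef : B = fun i => ν₂ i ^ 2 / (1 - U i) * (Q0 i + W i / (p i - T i) * Q1 i) := rfl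
  have hB0 : ∀ᶠ i in l, 0 ≤ B i := by
    filter_upwards [hU1, hχ0] with i h1 h2
    have := hQ0' i
    have := hQ1' i
    simp only [hBdef]; positivity
  have hB : B =Θ[l] fun i => ν₂ i ^ (2 * r) := by
    have h1 : (fun i => Q0 i + W i / (p i - T i) * Q1 i) =Θ[l] fun i =>
        ν₂ i ^ (2 * r) / ν₂ i ^ 2 + S i / ν₂ i / p i * (ν₂ i ^ (2 * r) / ν₂ i) := by
      refine isTheta_add_of_nonneg hQ0 (hχ.mul hQ1) (.of_forall hQ0') ?_ ?_ ?_
      · filter_upwards [hχ0] with i h using mul_nonneg h.le (hQ1' i)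
      · filter_upwards [hν] with i h; positivity
      · filter_upwards [hν, hS0, hp] with i h1 h2 h3; positivity
    have h2 := (((isTheta_refl ν₂ l).pow 2).div hU).mul h1
    rw [hBdef]
    -- The comparison function is (1 + S/p) ν^{2r} with 0 ≤ S/p ≤ 1, whence the constants 1 and 2.
    refine h2.trans (isTheta_of_bounds (c := 1) (C := 2) one_pos ?_ ?_ ?_) <;>
    filter_upwards [hfacts, hS0] with i ⟨h1, h2, h3, h4, h5, h6, h7, h8, h9, h10, h11, h12⟩ hSi
    · positivity
    all_goals
      have e : ν₂ i ^ 2 / 1 * (ν₂ i ^ (2 * r) / ν₂ i ^ 2 +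
          S i / ν₂ i / p i * (ν₂ i ^ (2 * r) / ν₂ i)) = (1 + S i / p i) * ν₂ i ^ (2 * r) := by
        field_simp
      rw [e]
      have hle : S i / p i ≤ 1 := by rw [div_le_one h2]; exact h6.le
      have hge : 0 ≤ S i / p i := by positivity
      gcongr
      linarith
  have hσ2 : (fun _ : ι => σ ^ 2) =Θ[l] fun _ => (1 : ℝ) :=
    isTheta_const_const (by positivity) one_ne_zero
  refine ⟨?_, ?_, ?_⟩
  · have hV : (fun i => σ ^ 2 * U i / (1 - U i)) =Θ[l] fun i => 1 * (S i / n i) / 1 :=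
      (hσ2.mul hUΘ).div hU
    simp only [one_mul, div_one] at hV
    refine isTheta_add_of_nonneg hB hV hB0 ?_ ?_ ?_
    · filter_upwards [hU0, hU1] with i h1 h2
      change 0 ≤ σ ^ 2 * U i / (1 - U i)
      positivity
    · filter_upwards [hν] with i h; positivity
    · filter_upwards [hS0, hn] with i h1 h2; positivity
  · have h1 : (fun i => p i * Q1 i / (p i - T i)) =Θ[l]
        fun i => p i * (ν₂ i ^ (2 * r) / ν₂ i) / p i := ((isTheta_refl p l).mul hQ1).div hpT
    have h2 : (fun i => p i * (W i / (p i - T i)) / n i * B i) =Θ[l]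
        fun i => p i * (S i / ν₂ i / p i) / n i * ν₂ i ^ (2 * r) :=
      (((isTheta_refl p l).mul hχ).div (isTheta_refl n l)).mul hB
    have h3 : (fun i => σ ^ 2 * (p i / n i) * (W i / (p i - T i) / (1 - U i))) =Θ[l]
        fun i => 1 * (p i / n i) * (S i / ν₂ i / p i / 1) :=
      (hσ2.mul (isTheta_refl _ l)).mul (hχ.div hU)
    have h12 := isTheta_add_of_nonneg h1 h2
      (by filter_upwards [hp, hpT0] with i h1 h2; have := hQ1' i; positivity)
      (by filter_upwards [hp, hχ0, hB0, hn] with i h1 h2 h3 h4; positivity)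
      (by filter_upwards [hp, hν] with i h1 h2; positivity)
      (by filter_upwards [hp, hν, hS0, hn] with i h1 h2 h3 h4; positivity)
    have h123 := isTheta_add_of_nonneg h12 h3
      (by
        filter_upwards [hp, hpT0, hχ0, hB0, hn] with i h1 h2 h3 h4 h5
        have := hQ1' i; positivity)
      (by filter_upwards [hp, hχ0, hU1, hn] with i h1 h2 h3 h4; positivity)
      (by filter_upwards [hp, hν, hS0, hn] with i h1 h2 h3 h4; positivity)
      (by filter_upwards [hp, hν, hS0, hn] with i h1 h2 h3 h4; positivity)
    refine ((isTheta_refl ν₂ l).mul h123).trans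
      (isTheta_of_bounds (c := 1) (C := 2) one_pos ?_ ?_ ?_) <;>
    filter_upwards [hfacts, hS0] with i ⟨h1, h2, h3, h4, h5, h6, h7, h8, h9, h10, h11, h12⟩ hSi
    · change 0 ≤ ν₂ i ^ (2 * r) + S i / n i
      positivity
    all_goals
      have e : ν₂ i * (p i * (ν₂ i ^ (2 * r) / ν₂ i) / p i +
          p i * (S i / ν₂ i / p i) / n i * ν₂ i ^ (2 * r) +
          1 * (p i / n i) * (S i / ν₂ i / p i / 1)) =
          ν₂ i ^ (2 * r) + S i / n i * ν₂ i ^ (2 * r) + S i / n i := by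
        field_simp
      rw [e]
      change _ ≤ _
      have hle : S i / n i ≤ 1 := by rw [div_le_one h1]; exact h7.le
      have hge : 0 ≤ S i / n i := by positivity
      have hpos : 0 ≤ ν₂ i ^ (2 * r) := by positivity
      have e' : df1 (powerSpectrum α) (ν₂ i) = S i := rfl
      rw [e']
      nlinarith [mul_nonneg hge hpos, mul_le_mul_of_nonneg_right hle hpos]
  · filter_upwards [hp, hpT0, hχ0, hB0, hn, hU1] with i h1 h2 h3 h4 h5 h6
    have := hQ1' i
    change 0 ≤ p i * Q1 i / (p i - T i) + p i * (W i / (p i - T i)) / n i * B i +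
      σ ^ 2 * (p i / n i) * (W i / (p i - T i) / (1 - U i))
    positivity

end RFM

end

/-! ### The three asymptotic regimes of the fixed-point equation. -/

noncomputable section

namespace RFM

open Asymptotics Filter Topology

theorem eventually_natCast_pos : ∀ᶠ n : ℕ in atTop, (0 : ℝ) < n := by
  filter_upwards [eventually_gt_atTop 0] with n hn using by exact_mod_cast hn

theorem natCast_rpow_isLittleO {s t : ℝ} (h : s < t) :
    (fun n : ℕ => (n : ℝ) ^ s) =o[atTop] fun n : ℕ => (n : ℝ) ^ t := by
  have hpos := eventually_natCast_pos
  rw [isLittleO_iff_tendsto'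
    (by filter_upwards [hpos] with n hn h0; exact absurd h0 (by positivity))]
  have := (tendsto_rpow_neg_atTop (sub_pos.2 h)).comp tendsto_natCast_atTop_atTop
  refine this.congr' ?_
  filter_upwards [hpos] with n hn
  simp only [Function.comp]
  rw [← Real.rpow_sub hn]; congr 1; ring

theorem tendsto_one_sub_div_natCast {S : ℕ → ℝ} {t : ℝ}
    (ht : S =O[atTop] fun n : ℕ => (n : ℝ) ^ t) (h1 : t < 1) :
    Tendsto (fun n : ℕ => 1 - S n / n) atTop (𝓝 1) := by
  have := (ht.trans_isLittleO (natCast_rpow_isLittleO h1)).tendsto_div_nhds_zero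
  simpa using this.const_sub 1

/-- The self-consistent equations along the scaling `lam = n^{1-ℓ}`, `p ≍ n^q`, in terms of the
degrees of freedom `S` and `S - D` and of `V = 1 - Υ`. -/
structure Scaling (α ℓ q : ℝ) (ν p S D V : ℕ → ℝ) : Prop where
  alpha_pos : 0 < α
  nu_pos : ∀ᶠ n in atTop, 0 < ν n
  S_pos : ∀ᶠ n in atTop, 0 < S n
  S_lt_p : ∀ᶠ n in atTop, S n < p n
  S_lt_n : ∀ᶠ n : ℕ in atTop, S n < n
  fixed_point : ∀ᶠ n : ℕ in atTop, (n : ℝ) ^ (-ℓ) = ν n * (1 - S n / p n) * (1 - S n / n)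
  S_theta : S =Θ[atTop] fun n => ν n ^ (-(1 / α))
  D_theta : D =Θ[atTop] S
  D_pos : ∀ᶠ n in atTop, 0 < D n
  p_theta : p =Θ[atTop] fun n : ℕ => (n : ℝ) ^ q
  V_le : ∀ᶠ n in atTop, V n ≤ 1
  le_V : ∀ᶠ n : ℕ in atTop, 1 - S n / n ≤ V n
  le_V' : ∀ᶠ n : ℕ in atTop, D n / n * (1 - S n / p n) ≤ V n

namespace Scaling

variable {α ℓ q : ℝ} {ν p S D V : ℕ → ℝ}

/-- One-sided inversion of S ≍ ν^{-1/α}: in the limited regimes only an upper bound on S is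
available until the limiting factor is shown to vanish. -/
theorem inv_nu_isBigO (h : Scaling α ℓ q ν p S D V)
    {t : ℝ} (ht : S =O[atTop] fun n : ℕ => (n : ℝ) ^ t) :
    (fun n => (ν n)⁻¹) =O[atTop] fun n : ℕ => (n : ℝ) ^ (t * α) := by
  have hα := h.alpha_pos
  have h1 := (h.S_theta.symm.isBigO.trans ht).rpow hα.le
    (.of_forall fun n => by simp only [Pi.zero_apply]; positivity)
  have e1 : (fun n => (ν n)⁻¹) =ᶠ[atTop] fun n => (ν n ^ (-(1 / α))) ^ α := by
    filter_upwards [h.nu_pos] with n hn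
    rw [← Real.rpow_mul hn.le]
    have : -(1 / α) * α = -1 := by field_simp
    rw [this, Real.rpow_neg_one]
  refine e1.trans_isBigO (h1.trans_eventuallyEq ?_)
  filter_upwards [eventually_natCast_pos] with n hn
  rw [← Real.rpow_mul hn.le]

theorem nu_theta (h : Scaling α ℓ q ν p S D V)
    {t : ℝ} (ht : S =Θ[atTop] fun n : ℕ => (n : ℝ) ^ t) :
    ν =Θ[atTop] fun n : ℕ => (n : ℝ) ^ (-(t * α)) := by
  have hα := h.alpha_pos
  have h1 := IsTheta.rpow (r := -α)
    (by filter_upwards [h.nu_pos] with n hn; simp only [Pi.zero_apply]; positivity)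
    (.of_forall fun n => by simp only [Pi.zero_apply]; positivity) (h.S_theta.symm.trans ht)
  have e1 : ν =ᶠ[atTop] fun n => (ν n ^ (-(1 / α))) ^ (-α) := by
    filter_upwards [h.nu_pos] with n hn
    rw [← Real.rpow_mul hn.le]
    have : -(1 / α) * -α = 1 := by field_simp
    rw [this, Real.rpow_one]
  refine e1.trans_isTheta (h1.trans_eventuallyEq ?_)
  filter_upwards [eventually_natCast_pos] with n hn
  rw [← Real.rpow_mul hn.le, mul_neg]

theorem tendsto_S_div_p (h : Scaling α ℓ q ν p S D V)
    {t : ℝ} (ht : S =O[atTop] fun n : ℕ => (n : ℝ) ^ t) (h1 : t < q) :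
    Tendsto (fun n : ℕ => 1 - S n / p n) atTop (𝓝 1) := by
  have := ((ht.trans_isLittleO (natCast_rpow_isLittleO h1)).trans_isTheta
    h.p_theta.symm).tendsto_div_nhds_zero
  simpa using this.const_sub 1

theorem V_theta_of_tendsto (h : Scaling α ℓ q ν p S D V)
    (hb : Tendsto (fun n : ℕ => 1 - S n / n) atTop (𝓝 1)) :
    V =Θ[atTop] fun _ => (1 : ℝ) := by
  refine isTheta_of_bounds (c := 1 / 2) (C := 1) (by norm_num) (by simp) ?_ ?_
  · filter_upwards [hb.eventually_const_le (show (1 / 2 : ℝ) < 1 by norm_num), h.le_V] with n h1 h2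
    linarith
  · filter_upwards [h.V_le] with n hn
    linarith

theorem fixed_point_theta (h : Scaling α ℓ q ν p S D V) :
    (fun n => ν n * (1 - S n / p n) * (1 - S n / n)) =Θ[atTop] fun n : ℕ => (n : ℝ) ^ (-ℓ) :=
  EventuallyEq.isTheta (h.fixed_point.mono fun _ hn => hn.symm)

/-- Ridge-dominated scaling: `ν₂ ≍ n^{-ℓ}`. -/
theorem ridge_dominated (h : Scaling α ℓ q ν p S D V)
    (h1 : ℓ < α) (h2 : ℓ / α < q) :
    V =Θ[atTop] (fun _ => (1 : ℝ)) ∧ ν =Θ[atTop] fun n : ℕ => (n : ℝ) ^ (-ℓ) := by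
  have hα := h.alpha_pos
  have hS : S =O[atTop] fun n : ℕ => (n : ℝ) ^ (ℓ / α) := by
    refine h.S_theta.isBigO.trans (isBigO_of_le_of_nonneg ?_ ?_)
    · filter_upwards [h.nu_pos] with n hn; positivity
    filter_upwards [h.nu_pos, h.S_pos, h.S_lt_p, h.S_lt_n, h.fixed_point, eventually_natCast_pos]
      with n g1 g2 g3 g4 g5 g6
    -- Both factors of the fixed-point equation are at most 1. This lower bound on ν makes S small
    -- compared with n and with p, so both factors tend to 1.
    have hle : (n : ℝ) ^ (-ℓ) ≤ ν n := by
      have e1 : 0 < S n / p n := div_pos g2 (g2.trans g3)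
      have e2 : 0 < S n / n := div_pos g2 g6
      have e3 : S n / p n < 1 := by rw [div_lt_one (g2.trans g3)]; exact g3
      have e4 : S n / n < 1 := by rw [div_lt_one g6]; exact g4
      rw [g5, mul_assoc]
      refine mul_le_of_le_one_right g1.le ?_
      exact mul_le_one₀ (by linarith) (by linarith) (by linarith)
    have e : (n : ℝ) ^ (ℓ / α) = ((n : ℝ) ^ (-ℓ)) ^ (-(1 / α)) := by
      rw [← Real.rpow_mul g6.le]; congr 1; field_simp
    rw [e]
    exact Real.rpow_le_rpow_of_nonpos (by positivity) hle
      (by rw [Left.neg_nonpos_iff]; positivity)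
  have hb := tendsto_one_sub_div_natCast hS (by rwa [div_lt_one hα])
  have ha := h.tendsto_S_div_p hS h2
  refine ⟨h.V_theta_of_tendsto hb, ?_⟩
  have := ((isTheta_refl ν atTop).mul (isTheta_one_of_tendsto ha)).mul (isTheta_one_of_tendsto hb)
  simp only [mul_one] at this
  exact this.symm.trans h.fixed_point_theta

/-- Scaling limited by the number of features: `Tr(Λ(Λ+ν₂)⁻¹) ≍ p`. -/
theorem feature_limited (h : Scaling α ℓ q ν p S D V)
    (h1 : q < 1) (h2 : q < ℓ / α) :
    V =Θ[atTop] (fun _ => (1 : ℝ)) ∧ ν =Θ[atTop] (fun n : ℕ => (n : ℝ) ^ (-(q * α))) ∧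
      S =Θ[atTop] fun n : ℕ => (n : ℝ) ^ q := by
  have hα := h.alpha_pos
  have hSp : S =O[atTop] p := isBigO_of_le_of_nonneg (h.S_pos.mono fun _ h => h.le)
    (h.S_lt_p.mono fun _ h => h.le)
  have hS := hSp.trans h.p_theta.isBigO
  have hb := tendsto_one_sub_div_natCast hS h1
  -- Solving the fixed-point equation for this factor gives O(n^{-ℓ + qα}), which vanishes since q <
  -- ℓ/α.
  have ha : Tendsto (fun n : ℕ => 1 - S n / p n) atTop (𝓝 0) := by
    have hO := ((isBigO_refl (fun n : ℕ => (n : ℝ) ^ (-ℓ)) atTop).mul (h.inv_nu_isBigO hS)).mul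
      (isTheta_one_of_tendsto hb).inv.isBigO
    have ho : (fun n : ℕ => (n : ℝ) ^ (-ℓ) * (n : ℝ) ^ (q * α) * (1 : ℝ)⁻¹) =o[atTop]
        fun _ => (1 : ℝ) := by
      have := natCast_rpow_isLittleO (s := -ℓ + q * α) (t := 0) (by
        rw [lt_div_iff₀ hα] at h2; linarith)
      simp only [Real.rpow_zero] at this
      refine EventuallyEq.trans_isLittleO ?_ this
      filter_upwards [eventually_natCast_pos] with n hn
      rw [Real.rpow_add hn]; simp
    refine ((isLittleO_one_iff ℝ).1 (hO.trans_isLittleO ho)).congr' ?_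
    filter_upwards [h.nu_pos, h.S_lt_n, h.fixed_point, eventually_natCast_pos] with n g1 g2 g3 g4
    have : 0 < 1 - S n / n := by rw [sub_pos, div_lt_one g4]; exact g2
    rw [g3]
    generalize 1 - S n / (n : ℝ) = b at *
    generalize 1 - S n / p n = a at *
    field_simp
  have hSθ : S =Θ[atTop] fun n : ℕ => (n : ℝ) ^ q := by
    have h3 : Tendsto (fun n => S n / p n) atTop (𝓝 1) := by simpa using ha.const_sub 1
    have h4 := (isTheta_one_of_tendsto h3).mul h.p_theta
    simp only [one_mul] at h4
    refine EventuallyEq.trans_isTheta ?_ h4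
    filter_upwards [h.S_pos, h.S_lt_p] with n g1 g2
    rw [div_mul_cancel₀]; linarith
  exact ⟨h.V_theta_of_tendsto hb, h.nu_theta hSθ, hSθ⟩

/-- Scaling limited by the number of samples: `Tr(Λ(Λ+ν₂)⁻¹) ≍ n`. -/
theorem sample_limited (h : Scaling α ℓ q ν p S D V)
    (h1 : α < ℓ) (h2 : 1 < q) :
    V =Θ[atTop] (fun _ => (1 : ℝ)) ∧ ν =Θ[atTop] fun n : ℕ => (n : ℝ) ^ (-α) := by
  have hα := h.alpha_pos
  have hS : S =O[atTop] fun n : ℕ => (n : ℝ) ^ (1 : ℝ) := by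
    simp only [Real.rpow_one]
    exact isBigO_of_le_of_nonneg (h.S_pos.mono fun _ h => h.le) (h.S_lt_n.mono fun _ h => h.le)
  have ha := h.tendsto_S_div_p hS h2
  -- The same argument with n in place of p: the factor is O(n^{-ℓ + α}).
  have hb : Tendsto (fun n : ℕ => 1 - S n / n) atTop (𝓝 0) := by
    have hO := ((isBigO_refl (fun n : ℕ => (n : ℝ) ^ (-ℓ)) atTop).mul (h.inv_nu_isBigO hS)).mul
      (isTheta_one_of_tendsto ha).inv.isBigO
    have ho : (fun n : ℕ => (n : ℝ) ^ (-ℓ) * (n : ℝ) ^ (1 * α) * (1 : ℝ)⁻¹) =o[atTop]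
        fun _ => (1 : ℝ) := by
      have := natCast_rpow_isLittleO (s := -ℓ + 1 * α) (t := 0) (by linarith)
      simp only [Real.rpow_zero] at this
      refine EventuallyEq.trans_isLittleO ?_ this
      filter_upwards [eventually_natCast_pos] with n hn
      rw [Real.rpow_add hn]; simp
    refine ((isLittleO_one_iff ℝ).1 (hO.trans_isLittleO ho)).congr' ?_
    filter_upwards [h.nu_pos, h.S_pos, h.S_lt_p, h.fixed_point] with n g1 g2 g3 g4
    have : 0 < 1 - S n / p n := by rw [sub_pos, div_lt_one (g2.trans g3)]; exact g3
    rw [g4]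
    generalize 1 - S n / (n : ℝ) = b at *
    generalize 1 - S n / p n = a at *
    field_simp
  have h3 : Tendsto (fun n : ℕ => S n / n) atTop (𝓝 1) := by simpa using hb.const_sub 1
  have hSn := isTheta_one_of_tendsto h3
  have hSθ : S =Θ[atTop] fun n : ℕ => (n : ℝ) ^ (1 : ℝ) := by
    have h4 := hSn.mul (isTheta_refl (fun n : ℕ => (n : ℝ)) atTop)
    simp only [one_mul] at h4
    simp only [Real.rpow_one]
    refine EventuallyEq.trans_isTheta ?_ h4
    filter_upwards [eventually_natCast_pos] with n g1
    rw [div_mul_cancel₀ _ g1.ne']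
  refine ⟨⟨?_, ?_⟩, by simpa using h.nu_theta hSθ⟩
  · refine isBigO_of_le_of_nonneg ?_ h.V_le
    filter_upwards [h.le_V, h.S_lt_n, eventually_natCast_pos] with n g1 g2 g3
    have : S n / n < 1 := by rw [div_lt_one g3]; exact g2
    linarith
  -- Here S/n tends to 1, so 1 - S/n no longer bounds 1 - Υ away from 0. The other bound does: D is
  -- of order n and S/p tends to 0.
  · have h5 := ((h.D_theta.div (isTheta_refl (fun n : ℕ => (n : ℝ)) atTop)).trans hSn).mul
      (isTheta_one_of_tendsto ha)
    simp only [mul_one] at h5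
    refine h5.2.trans (isBigO_of_le_of_nonneg ?_ h.le_V')
    filter_upwards [h.D_pos, h.S_pos, h.S_lt_p] with n g1 g2 g3
    have : 0 < 1 - S n / p n := by rw [sub_pos, div_lt_one (g2.trans g3)]; exact g3
    positivity

end Scaling

/-- The solution `ν₂` stays bounded. -/
theorem exists_nu_le {Λ : ℕ → ℝ} (hΛ : ∀ k, 0 < Λ k) (hs : Summable Λ) {ℓ : ℝ} (hℓ : 0 ≤ ℓ)
    {p ν : ℕ → ℝ} (hp : ∀ᶠ n in atTop, 1 / 2 ≤ p n) (hν : ∀ᶠ n in atTop, 0 < ν n)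
    (hfix : ∀ᶠ n : ℕ in atTop,
      (n : ℝ) ^ (-ℓ) = ν n * (1 - df1 Λ (ν n) / p n) * (1 - df1 Λ (ν n) / n)) :
    ∃ M : ℝ, ∀ᶠ n in atTop, ν n ≤ M := by
  set Z := ∑' k, Λ k
  refine ⟨max 4 (4 * Z), ?_⟩
  filter_upwards [hp, hν, hfix, eventually_ge_atTop 1] with n h1 h2 h3 h4
  by_contra! hlt
  have h4' : (1 : ℝ) ≤ n := by exact_mod_cast h4
  obtain ⟨h5, h6⟩ := max_lt_iff.1 hlt
  -- A value of ν above both 4 and 4Z makes both factors at least 1/2, so the right side exceeds 1 ≥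
  -- n^{-ℓ}.
  have hS : df1 Λ (ν n) ≤ 1 / 4 := by
    refine (df1_le hΛ hs h2).trans ?_
    rw [div_le_iff₀ h2]; linarith
  have ha : 1 / 2 ≤ 1 - df1 Λ (ν n) / p n := by
    have : df1 Λ (ν n) / p n ≤ 1 / 2 := by rw [div_le_iff₀ (by linarith)]; linarith
    linarith
  have hb : 1 / 2 ≤ 1 - df1 Λ (ν n) / n := by
    have : df1 Λ (ν n) / n ≤ 1 / 2 := by rw [div_le_iff₀ (by linarith)]; linarith
    linarith
  have hle : (n : ℝ) ^ (-ℓ) ≤ 1 := Real.rpow_le_one_of_one_le_of_nonpos h4' (by linarith)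
  have hab : 1 / 2 * (1 / 2) ≤ (1 - df1 Λ (ν n) / p n) * (1 - df1 Λ (ν n) / n) :=
    mul_le_mul ha hb (by norm_num) (by linarith)
  rw [h3, mul_assoc] at hle
  nlinarith

/-- A power law for the risk against the norm, when both are pure powers of `n`. -/
theorem isTheta_rpow_mul_rpow {R N ν : ℕ → ℝ} {e s γ γ' : ℝ}
    (hR : R =Θ[atTop] fun n : ℕ => (n : ℝ) ^ e)
    (hN : (fun n => ν n * N n) =Θ[atTop] fun n : ℕ => (n : ℝ) ^ e)
    (hν : ν =Θ[atTop] fun n : ℕ => (n : ℝ) ^ (-s)) (hν0 : ∀ᶠ n in atTop, 0 < ν n)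
    (hN0 : ∀ᶠ n in atTop, 0 ≤ N n) (he : γ + (e + s) * γ' = e) :
    R =Θ[atTop] fun n : ℕ => (n : ℝ) ^ γ * N n ^ γ' := by
  have h1 : N =Θ[atTop] fun n : ℕ => (n : ℝ) ^ (e + s) := by
    refine EventuallyEq.trans_isTheta ?_ ((hN.div hν).trans_eventuallyEq ?_)
    · filter_upwards [hν0] with n hn
      rw [mul_div_cancel_left₀ _ hn.ne']
    · filter_upwards [eventually_natCast_pos] with n hn
      rw [← Real.rpow_sub hn, sub_neg_eq_add]
  have h2 := (isTheta_refl (fun n : ℕ => (n : ℝ) ^ γ) atTop).mul (h1.rpow (r := γ') hN0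
    (.of_forall fun n => by simp only [Pi.zero_apply]; positivity))
  refine hR.trans (EventuallyEq.trans_isTheta ?_ h2.symm)
  filter_upwards [eventually_natCast_pos] with n hn
  rw [← Real.rpow_mul hn.le, ← Real.rpow_add hn, he]

end RFM

end

/-! ### Signs of the exponents, verification of the scaling data, and the five regions. -/

noncomputable section

namespace RFM

open Asymptotics Filter Topology

theorem Region.gammaSample_nonpos {α ℓ : ℝ} (hα : 1 < α) (hℓ : 0 ≤ ℓ) (A : Region) :
    A.gammaSample α ℓ ≤ 0 := by
  cases A <;> simp only [gammaSample, Left.neg_nonpos_iff, le_refl]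
  · linarith
  · exact hℓ
  · positivity
  · exact hℓ

theorem Region.gammaNorm_pos {α r : ℝ} (hα : 1 < α) (A : Region) (hA : A ≠ .five) :
    0 < A.gammaNorm α r := by
  cases A <;> simp only [gammaNorm, zero_lt_one] <;> first | positivity | exact absurd rfl hA

theorem Region.gammaNorm_five_neg {α r : ℝ} (hr₀ : 0 < r) (hr₁ : r < 1 / 2) :
    Region.five.gammaNorm α r < 0 := by
  have : 0 < 1 - 2 * r := by linarith
  simp only [gammaNorm, Left.neg_neg_iff]
  positivity

theorem eventually_half_le {p : ℕ → ℝ} {q : ℝ} (hq : 0 ≤ q)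
    (hp : p ~[atTop] fun n : ℕ => (n : ℝ) ^ q) : ∀ᶠ n in atTop, 1 / 2 ≤ p n := by
  have h := (isEquivalent_iff_tendsto_one (by
    filter_upwards [eventually_natCast_pos] with n hn; positivity)).1 hp
  filter_upwards [h.eventually_const_le (show (1 / 2 : ℝ) < 1 by norm_num),
    eventually_ge_atTop 1] with n h1 h2
  have h3 : (1 : ℝ) ≤ (n : ℝ) ^ q := Real.one_le_rpow (by exact_mod_cast h2) hq
  simp only [Pi.div_apply] at h1
  rw [le_div_iff₀ (by linarith)] at h1
  linarith

theorem scaling_of_selfConsistent {α q ℓ : ℝ} (hα : 1 < α) (hq : 0 ≤ q) (hℓ : 0 ≤ ℓ)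
    {p lam ν₁ ν₂ : ℕ → ℝ} (hp₀ : ∀ n, 1 ≤ n → 0 < p n)
    (hp : p ~[atTop] fun n : ℕ => (n : ℝ) ^ q) (hlam : ∀ n : ℕ, lam n = (n : ℝ) ^ (-(ℓ - 1)))
    (hsc : ∀ n : ℕ, 1 ≤ n → SelfConsistent (powerSpectrum α) n (p n) (lam n) (ν₁ n) (ν₂ n)) :
    (∃ M, ∀ᶠ n in atTop, ν₂ n ≤ M) ∧
    Scaling α ℓ q ν₂ p (fun n => df1 (powerSpectrum α) (ν₂ n))
      (fun n => ν₂ n * trRes2 (powerSpectrum α) (ν₂ n))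
      (fun n => 1 - Upsilon (powerSpectrum α) n (p n) (ν₁ n) (ν₂ n)) := by
  have hfacts := (eventually_ge_atTop 1).mono fun (n : ℕ) (hn : 1 ≤ n) =>
    have hn0 : (0 : ℝ) < n := by exact_mod_cast hn
    And.intro hn0 (selfConsistent_facts hα hn0 (hp₀ n hn)
      (by rw [hlam]; positivity) (hsc n hn))
  have hν : ∀ᶠ n in atTop, 0 < ν₂ n := hfacts.mono fun n h => h.2.1
  have hfix : ∀ᶠ n : ℕ in atTop, (n : ℝ) ^ (-ℓ) =
      ν₂ n * (1 - df1 (powerSpectrum α) (ν₂ n) / p n) *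
        (1 - df1 (powerSpectrum α) (ν₂ n) / n) := by
    filter_upwards [hfacts] with n ⟨h1, h2, h3, h4, h5, h6, h7, h8, h9, h10, h11⟩
    have e : (n : ℝ) ^ (-ℓ) = lam n / n := by
      rw [hlam, ← Real.rpow_sub_one h1.ne']; congr 1; ring
    rw [e, h8, mul_div_assoc, sub_div, div_self h1.ne']
  obtain ⟨M, hM⟩ := exists_nu_le (powerSpectrum_pos α) (summable_powerSpectrum hα) hℓ
    (eventually_half_le hq hp) hν hfix
  obtain ⟨hS, -, hD⟩ := isTheta_df hα hν hM
  refine ⟨⟨M, hM⟩, ⟨by linarith, hν, ?_, ?_, ?_, hfix, hS, hD, ?_, hp.isTheta, ?_, ?_, ?_⟩⟩ <;>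
  filter_upwards [hfacts] with n ⟨h1, h2, h3, h4, h5, h6, h7, h8, h9, h10, h11⟩
  · exact df1_pos (powerSpectrum_pos α) (summable_powerSpectrum hα) h2
  · exact h5
  · exact h6
  · positivity
  · have : 0 < df2 (powerSpectrum α) (ν₂ n) / n := by positivity
    linarith
  · linarith
  · exact h11

end RFM

end

theorem mainTheorem10 (α r σ q ℓ : ℝ) (hα : 1 < α) (hr₀ : 0 < r) (hr₁ : r < 1 / 2)
    (hσ : σ ≠ 0) (hq : 0 ≤ q) (hℓ : 0 ≤ ℓ)
    (p lam : ℕ → ℝ) (hp₀ : ∀ n, 1 ≤ n → 0 < p n)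
    (hp : Asymptotics.IsEquivalent Filter.atTop p (fun n : ℕ => (n : ℝ) ^ q))
    (hlam : ∀ n : ℕ, lam n = (n : ℝ) ^ (-(ℓ - 1))) :
    (∀ n : ℕ, 1 ≤ n →
      ∃! ν : ℝ × ℝ, RFM.SelfConsistent (RFM.powerSpectrum α) n (p n) (lam n) ν.1 ν.2) ∧
    (∀ ν₁ ν₂ : ℕ → ℝ,
      (∀ n : ℕ, 1 ≤ n →
        RFM.SelfConsistent (RFM.powerSpectrum α) n (p n) (lam n) (ν₁ n) (ν₂ n)) →
      ∀ A : RFM.Region, A.Contains α r ℓ q →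
        Asymptotics.IsTheta Filter.atTop
          (fun n : ℕ => RFM.detRisk (RFM.powerSpectrum α) (RFM.powerTarget α r) σ n (p n)
            (ν₁ n) (ν₂ n))
          (fun n : ℕ => (n : ℝ) ^ A.gammaSample α ℓ *
            RFM.detNorm (RFM.powerSpectrum α) (RFM.powerTarget α r) σ n (p n)
              (ν₁ n) (ν₂ n) ^ A.gammaNorm α r)) ∧
    (∀ A : RFM.Region, A.gammaSample α ℓ ≤ 0) ∧
    (∀ A : RFM.Region, A ≠ RFM.Region.five → 0 < A.gammaNorm α r) ∧
    RFM.Region.five.gammaNorm α r < 0 := by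
  refine ⟨fun n hn => ?_, fun ν₁ ν₂ hsc A hA => ?_, RFM.Region.gammaSample_nonpos hα hℓ,
    RFM.Region.gammaNorm_pos hα, RFM.Region.gammaNorm_five_neg hr₀ hr₁⟩
  · have hn0 : (0 : ℝ) < n := by exact_mod_cast hn
    exact RFM.existsUnique_selfConsistent (RFM.powerSpectrum_pos α)
      (RFM.summable_powerSpectrum hα) hn0 (hp₀ n hn) (by rw [hlam]; positivity)
  have hα0 : 0 < α := by linarith
  have hαr : 0 < 2 * α * r := by positivity
  obtain ⟨⟨M, hM⟩, hs⟩ := RFM.scaling_of_selfConsistent hα hq hℓ hp₀ hp hlam hsc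
  have hRN := fun hV => RFM.isTheta_detRisk_detNorm hα hr₀ hr₁ hσ RFM.eventually_natCast_pos
    ((Filter.eventually_ge_atTop 1).mono hp₀)
    (RFM.eventually_natCast_pos.mono fun n hn => by rw [hlam]; positivity)
    ((Filter.eventually_ge_atTop 1).mono hsc) hM hV
  have linear : ∀ {s : ℝ},
      ((fun n : ℕ => 1 - RFM.Upsilon (RFM.powerSpectrum α) n (p n) (ν₁ n) (ν₂ n))
        =Θ[Filter.atTop] fun _ => (1 : ℝ)) →
      (ν₂ =Θ[Filter.atTop] fun n : ℕ => (n : ℝ) ^ (-s)) →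
      (fun n : ℕ => RFM.detRisk (RFM.powerSpectrum α) (RFM.powerTarget α r) σ n (p n)
        (ν₁ n) (ν₂ n)) =Θ[Filter.atTop] fun n : ℕ => (n : ℝ) ^ (-s) *
          RFM.detNorm (RFM.powerSpectrum α) (RFM.powerTarget α r) σ n (p n)
            (ν₁ n) (ν₂ n) ^ (1 : ℝ) := by
    intro s hV hν
    obtain ⟨hR, hN, -⟩ := hRN hV
    simp only [Real.rpow_one]
    exact (hR.trans hN.symm).trans (hν.mul (Asymptotics.isTheta_refl _ _))
  have sum_theta : q < 1 → q < ℓ / α →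
      (fun n : ℕ => ν₂ n ^ (2 * r) + RFM.df1 (RFM.powerSpectrum α) (ν₂ n) / n)
        =Θ[Filter.atTop] fun n : ℕ => (n : ℝ) ^ (-(q * α) * (2 * r)) + (n : ℝ) ^ (q - 1) := by
    intro h1 h2
    obtain ⟨-, hν, hS⟩ := hs.feature_limited h1 h2
    refine RFM.isTheta_add_of_nonneg ?_ ?_ ?_ ?_ ?_ ?_
    · have h := hν.rpow (r := 2 * r) (hs.nu_pos.mono fun _ h => h.le)
        (.of_forall fun n => by simp only [Pi.zero_apply]; positivity)
      refine h.trans_eventuallyEq (.of_eq (funext fun n => ?_))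
      rw [← Real.rpow_mul (by positivity)]
    · refine (hS.div (Asymptotics.isTheta_refl (fun n : ℕ => (n : ℝ)) _)).trans_eventuallyEq ?_
      filter_upwards [RFM.eventually_natCast_pos] with n hn
      rw [Real.rpow_sub_one hn.ne']
    · filter_upwards [hs.nu_pos] with n hn; positivity
    · filter_upwards [hs.S_pos, RFM.eventually_natCast_pos] with n h1 h2; positivity
    · exact .of_forall fun n => by positivity
    · exact .of_forall fun n => by positivity
  cases A with
  | one =>
    obtain ⟨h1, h2⟩ := hA
    obtain ⟨hV, hν⟩ := hs.sample_limited h1 h2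
    exact linear hV hν
  | two =>
    obtain ⟨-, h1, h2⟩ := hA
    obtain ⟨hV, hν⟩ := hs.ridge_dominated h1 h2
    exact linear hV hν
  | three =>
    obtain ⟨h1, h2, h3⟩ := hA
    obtain ⟨hV, hν, -⟩ := hs.feature_limited h2 h3
    obtain ⟨hR, hN, hN0⟩ := hRN hV
    -- The line q = 1/(2αr + 1) is where the exponents -2rqα and q - 1 agree. Above it the variance
    -- term n^{q-1} dominates, and N is of order n^{q-1+qα}.
    rw [div_lt_iff₀ (by linarith)] at h1
    have hsum := (sum_theta h2 h3).trans (RFM.natCast_rpow_isLittleO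
      (show -(q * α) * (2 * r) < q - 1 by nlinarith)).right_isTheta_add.symm
    refine RFM.isTheta_rpow_mul_rpow (hR.trans hsum) (hN.trans hsum) hν hs.nu_pos hN0 ?_
    simp only [RFM.Region.gammaSample, RFM.Region.gammaNorm]
    field_simp
    ring
  | four =>
    obtain ⟨h1, h2⟩ := hA
    -- Regions 2 and 4 share one regime; the line ℓ = α/(2αr + 1) separating them does not change
    -- the order of ν.
    have h3 : ℓ < α := h1.trans_le (div_le_self hα0.le (by linarith))
    obtain ⟨hV, hν⟩ := hs.ridge_dominated h3 h2
    exact linear hV hν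
  | five =>
    obtain ⟨h1, h3⟩ := hA
    have h2 : q < 1 := h1.trans_le (by rw [div_le_one] <;> linarith)
    obtain ⟨hV, hν, -⟩ := hs.feature_limited h2 h3
    obtain ⟨hR, hN, hN0⟩ := hRN hV
    -- Below the same line the bias term n^{-2rqα} dominates, and N is of order n^{qα(1-2r)}: it
    -- grows as R decays, hence the negative exponent.
    rw [lt_div_iff₀ (by linarith)] at h1
    have hsum := (sum_theta h2 h3).trans (RFM.natCast_rpow_isLittleO
      (show q - 1 < -(q * α) * (2 * r) by nlinarith)).right_isTheta_add'.symm
    refine RFM.isTheta_rpow_mul_rpow (hR.trans hsum) (hN.trans hsum) hν hs.nu_pos hN0 ?_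
    have : 1 - 2 * r ≠ 0 := by linarith
    simp only [RFM.Region.gammaSample, RFM.Region.gammaNorm]
    field_simp
    ring
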